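/- There are absolute constants $C, C' > 0$ such that the following holds. Let $n \ge 1$ and $p \ge 2$, let $X_1, \dots, X_n \in \mathbb{R}^p$ be i.i.d. copies of a sub-Gaussian random vector $\tilde X$ with $\Sigma_0 := \mathbb{E}[\tilde X \tilde X^T]$ (the covariance matrix of $\tilde X$ if $\tilde X$ is centred), and let $c_1 > 0$ satisfy $\mathbb{E}[\langle \tilde X, u\rangle^2] \ge c_1 \|\langle \tilde X, u\rangle\|_{\psi_2}^2$ for all $u \in \mathbb{R}^p$, where $\|Z\|_{\psi_2} = \inf\{K > 0 : \mathbb{E}[\exp((|Z|/K)^2) - 1] \le 1\}$. Let $0 < \delta \le 1$ and let $\delta_{ij}$ ($1 \le i \le n$, $1 \le j \le p$) be i.i.d. Bernoulli($\delta$) random variables, independent of $(X_1, \dots, X_n)$. We observe $Y_{ij} = \delta_{ij} X_{ij}$ and put $$\tilde\Sigma = \frac{1}{\delta^2}\frac{Y^TY}{n} - \frac{1-\delta}{\delta^2}\,\mathrm{diag}\Big(\frac{Y^TY}{n}\Big).$$ Let $\Lambda_{\max} = \Lambda_1 > \Lambda_2$ be the two largest eigenvalues of $\Sigma_0$, let $u_1$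 be a unit eigenvector of $\Sigma_0$ for $\Lambda_1$, put $\beta^0 = \Lambda_1^{1/2} u_1$, and let $s \in \mathbb{N}$ be at least the number of non-zero entries of $\beta^0$. With $\|\Sigma_0\|$ the spectral norm and $\mathbf r(\Sigma_0) = \mathrm{trace}(\Sigma_0)/\|\Sigma_0\|$ the effective rank, define $$\mu(t) = C' \frac{\|\Sigma_0\|}{c_1} \max\left\{ \sqrt{\frac{\mathbf r(\Sigma_0)(t + \log(2p))}{\delta^2 n}},\ \frac{\mathbf r(\Sigma_0)(t + \log(2p))}{\delta^2 n}\,(c_1\delta + t + \log n)\right\}.$$ Let $\mu \ge \mu(\log(2p))$ be the tuning parameter (for instance $\mu = \mu(\log(2p))$), let $\varepsilon \ge 0$ be given by $$\varepsilon^2 = \frac{4 C s^2\mu^2}{(\Lambda_1 - \Lambda_2)^2}, \qquad\text{and let}\qquad \alpha = s\mu + \varepsilon^2 + 6\|\beta^0\|_2^2\,\varepsilon + 4\|\beta^0\|_2\sqrt{\varepsilon}.$$ Assume $\Lambda_{\max} > \alpha$. Then, with probability at least $1 - \exp(-\log(2p))$, for every solution $\hat F$ of the semidefinite program $$\text{minimize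 } -\mathrm{trace}(\tilde\Sigma F) + \mu \sum_{j,k}|F_{jk}| \quad\text{subject to } \mathrm{trace}(F) = 1,\ 0 \preceq F \preceq I,$$ and every unit eigenvector $\hat u_1$ of $\hat F$ for the largest eigenvalue of $\hat F$, with sign such that $\hat u_1^T u_1 \ge 0$, the estimator $\hat\beta_{\mathrm{init}} = |\mathrm{trace}(\tilde\Sigma \hat F)|^{1/2}\,\hat u_1$ satisfies $$\|\hat\beta_{\mathrm{init}} - \beta^0\|_2 \le \frac{\alpha}{2\sqrt{\Lambda_{\max} - \alpha}} + 2\sqrt{\varepsilon}\,\Lambda_{\max}^{1/2}.$$ -/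

import Mathlib

open MeasureTheory ProbabilityTheory
open scoped ENNReal

noncomputable section

namespace SparsePCA

/-- The Orlicz norm of a real random variable for `ψ₂ x = exp (x ^ 2) - 1`, i.e.
`inf {C > 0 : E ψ₂ (|Z| / C) ≤ 1}`, with values in `[0, ∞]`
(it is `∞` when no such `C` exists). -/
def psi2Norm {Ω : Type*} [MeasurableSpace Ω] (Z : Ω → ℝ) (P : Measure Ω) : ℝ≥0∞ :=
  sInf {c : ℝ≥0∞ | ∃ C : ℝ, 0 < C ∧ c = ENNReal.ofReal C ∧
    ∫⁻ ω, ENNReal.ofReal (Real.exp ((|Z ω| / C) ^ 2) - 1) ∂P ≤ 1}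

/-- A random vector is sub-Gaussian when all its one-dimensional marginals have a finite
`ψ₂` norm. -/
def IsSubGaussian {Ω : Type*} [MeasurableSpace Ω] {p : ℕ} (Z : Ω → Fin p → ℝ)
    (P : Measure Ω) : Prop :=
  ∀ u : Fin p → ℝ, psi2Norm (fun ω => Z ω ⬝ᵥ u) P < ∞

/-- `Σ₀ = E [Z Zᵀ]`. -/
def covMatrix {Ω : Type*} [MeasurableSpace Ω] {p : ℕ} (Z : Ω → Fin p → ℝ)
    (P : Measure Ω) : Matrix (Fin p) (Fin p) ℝ :=
  Matrix.of fun j k => ∫ ω, Z ω j * Z ω k ∂P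

theorem covMatrix_isHermitian {Ω : Type*} [MeasurableSpace Ω] {p : ℕ} (Z : Ω → Fin p → ℝ)
    (P : Measure Ω) : (covMatrix Z P).IsHermitian := by
  ext j k
  simp [covMatrix, mul_comm]

/-- The eigenvalues, with multiplicity, of a symmetric matrix in decreasing order; `k = 0` is
the largest one and `k = 1` the second largest one. -/
def eigval {p : ℕ} {A : Matrix (Fin p) (Fin p) ℝ} (hA : A.IsHermitian) (k : ℕ) (hk : k < p) : ℝ :=
  hA.eigenvalues₀ ⟨k, by simpa using hk⟩

/-- `v` is a unit eigenvector of `A` for the largest eigenvalue of `A`. -/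
def IsLeadingEigenvector {p : ℕ} (A : Matrix (Fin p) (Fin p) ℝ)
    (v : EuclideanSpace ℝ (Fin p)) : Prop :=
  ‖v‖ = 1 ∧ ∃ m : ℝ, Matrix.toEuclideanLin A v = m • v ∧
    ∀ l : ℝ, Module.End.HasEigenvalue (Matrix.toEuclideanLin A) l → l ≤ m

/-- The spectral norm of a matrix (operator norm with respect to Euclidean norms). -/
def specNorm {p : ℕ} (A : Matrix (Fin p) (Fin p) ℝ) : ℝ :=
  ‖Matrix.toEuclideanCLM (𝕜 := ℝ) A‖

/-- The effective rank `trace A / ‖A‖`. -/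
def effRank {p : ℕ} (A : Matrix (Fin p) (Fin p) ℝ) : ℝ :=
  A.trace / specNorm A

/-- The data matrix with missing entries, `Y i j = δ i j * X i j`. -/
def maskedData {n p : ℕ} (X : Fin n → Fin p → ℝ) (D : Fin n → Fin p → ℝ) :
    Matrix (Fin n) (Fin p) ℝ :=
  Matrix.of fun i j => D i j * X i j

/-- The bias-corrected covariance estimator
`δ⁻² (Yᵀ Y / n) - (1 - δ) δ⁻² diag (Yᵀ Y / n)`. -/
def biasCorrected {n p : ℕ} (δ : ℝ) (Y : Matrix (Fin n) (Fin p) ℝ) :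
    Matrix (Fin p) (Fin p) ℝ :=
  let S : Matrix (Fin p) (Fin p) ℝ := (1 / (n : ℝ)) • (Y.transpose * Y)
  (1 / δ ^ 2) • S - ((1 - δ) / δ ^ 2) • Matrix.diagonal S.diag

/-- The entrywise `ℓ₁` norm of a matrix. -/
def entryL1 {p : ℕ} (F : Matrix (Fin p) (Fin p) ℝ) : ℝ :=
  ∑ j, ∑ k, |F j k|

/-- The feasible set `trace F = 1`, `0 ⪯ F ⪯ I` of the semidefinite program. -/
def fantope (p : ℕ) : Set (Matrix (Fin p) (Fin p) ℝ) :=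
  {F | F.trace = 1 ∧ F.PosSemidef ∧ (1 - F).PosSemidef}

/-- `F` minimises `- trace (S F) + μ ‖F‖₁` over `trace F = 1`, `0 ⪯ F ⪯ I`. -/
def IsSDPSolution {p : ℕ} (S : Matrix (Fin p) (Fin p) ℝ) (μ : ℝ)
    (F : Matrix (Fin p) (Fin p) ℝ) : Prop :=
  F ∈ fantope p ∧
    IsMinOn (fun G : Matrix (Fin p) (Fin p) ℝ => - (S * G).trace + μ * entryL1 G) (fantope p) F

/-- The rescaled initial estimator `|trace (S F)|^{1/2} û`. -/
def betaInit {p : ℕ} (S F : Matrix (Fin p) (Fin p) ℝ) (u : EuclideanSpace ℝ (Fin p)) :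
    EuclideanSpace ℝ (Fin p) :=
  Real.sqrt |(S * F).trace| • u

/-- The effective-rank noise level
`C ‖Σ₀‖ / c₁ * max (√(r (t + log 2p) / (δ² n))) (r (t + log 2p) / (δ² n) * (c₁ δ + t + log n))`. -/
def noiseLevel {p : ℕ} (C c₁ δ : ℝ) (n : ℕ) (S₀ : Matrix (Fin p) (Fin p) ℝ) (t : ℝ) : ℝ :=
  C * (specNorm S₀ / c₁) *
    max (Real.sqrt (effRank S₀ * (t + Real.log (2 * p)) / (δ ^ 2 * n)))
      (effRank S₀ * (t + Real.log (2 * p)) / (δ ^ 2 * n) * (c₁ * δ + t + Real.log n))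

/-- `ε`, where `ε² = 4 C s² μ² / (Λ₁ - Λ₂)²`. -/
def epsilon (C s μ Λ₁ Λ₂ : ℝ) : ℝ :=
  Real.sqrt (4 * C * s ^ 2 * μ ^ 2 / (Λ₁ - Λ₂) ^ 2)

/-- `α = s μ + ε² + 6 b² ε + 4 b √ε`, with `b = ‖β⁰‖₂`. -/
def alpha (s μ ε b : ℝ) : ℝ :=
  s * μ + ε ^ 2 + 6 * b ^ 2 * ε + 4 * b * Real.sqrt ε

end SparsePCA

end

noncomputable section

namespace SparsePCA

open Matrix

/-! ### Deterministic analysis of the semidefinite program -/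

section Deterministic

variable {p : ℕ}

/-! Write `E = u₁ u₁ᵀ`, `Δ = F̂ - E`. The proof separates a deterministic bound, valid when every
entry of `Σ̃ - Σ₀` is at most `μ / 2` in absolute value, from a concentration bound showing that
this event is likely.

Deterministic part (`IsSDPSolution.error_bounds`, `norm_betaInit_sub_le`). The eigengap makes the
linear objective curved around `E`: on the feasible set `tr (Σ₀ (E - F)) ≥ (Λ₁ - Λ₂) / 2 * ‖F - E‖²`
in Frobenius norm. Comparing `F̂` with `E`, the penalty absorbs the noise off the support of `E`,
and on the support Cauchy–Schwarz gives `‖Δ‖ ≤ 3 s μ / (Λ₁ - Λ₂) ≤ ε`. A leading eigenvector of `F̂`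
is then within `2 √ε` of `u₁`, and `tr (Σ̃ F̂)` is within `s μ ≤ α` of `Λ₁`; combining the two
yields the bound on `β̂`.

Probabilistic part (`measureReal_le_abs_biasCorrected_sub_le`). Each entry of `Σ̃` is an average of
independent, inverse-probability-weighted products of sub-Gaussian variables, hence sub-exponential.
A Bernstein bound at level `3 log (2p)` and a union bound over `p²` entries give the event. The
effective rank is at least `1`, so the prescribed noise level exceeds the entrywise deviation. -/

theorem inner_eq_dotProduct (x y : EuclideanSpace ℝ (Fin p)) :
    inner ℝ x y = x.ofLp ⬝ᵥ y.ofLp := by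
  rw [EuclideanSpace.inner_eq_star_dotProduct, dotProduct_comm]
  simp

theorem dotProduct_mulVec_comm_of_isHermitian {A : Matrix (Fin p) (Fin p) ℝ}
    (hA : A.IsHermitian) (x y : Fin p → ℝ) : x ⬝ᵥ A *ᵥ y = (A *ᵥ x) ⬝ᵥ y := by
  have hT : Aᵀ = A := by simpa using hA.eq
  rw [dotProduct_mulVec, ← mulVec_transpose, hT]

/-- The quadratic form of a symmetric matrix in an orthonormal basis of eigenvectors. -/
theorem dotProduct_mulVec_self_eq_sum {A : Matrix (Fin p) (Fin p) ℝ} (hA : A.IsHermitian)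
    (x : EuclideanSpace ℝ (Fin p)) :
    x.ofLp ⬝ᵥ A *ᵥ x.ofLp
      = ∑ i, hA.eigenvalues i * inner ℝ (hA.eigenvectorBasis i) x ^ 2 := by
  have h := (hA.eigenvectorBasis).sum_inner_mul_inner x (WithLp.toLp 2 (A *ᵥ x.ofLp))
  rw [inner_eq_dotProduct] at h
  rw [← h]
  refine Finset.sum_congr rfl fun i _ => ?_
  rw [inner_eq_dotProduct (hA.eigenvectorBasis i) (WithLp.toLp 2 _),
    dotProduct_mulVec_comm_of_isHermitian hA, IsHermitian.mulVec_eigenvectorBasis, smul_dotProduct,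
    ← inner_eq_dotProduct, real_inner_comm, smul_eq_mul]
  ring

theorem hasEigenvalue_eigenvalues {A : Matrix (Fin p) (Fin p) ℝ} (hA : A.IsHermitian)
    (i : Fin p) : Module.End.HasEigenvalue (Matrix.toEuclideanLin A) (hA.eigenvalues i) :=
  LinearMap.IsSymmetric.hasEigenvalue_eigenvalues _ _ _

/-- A leading eigenvector maximises the quadratic form on the unit sphere. -/
theorem IsLeadingEigenvector.dotProduct_mulVec_le {A : Matrix (Fin p) (Fin p) ℝ}
    (hA : A.IsHermitian) {v : EuclideanSpace ℝ (Fin p)} (hv : IsLeadingEigenvector A v)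
    (x : EuclideanSpace ℝ (Fin p)) :
    x.ofLp ⬝ᵥ A *ᵥ x.ofLp ≤ (v.ofLp ⬝ᵥ A *ᵥ v.ofLp) * ‖x‖ ^ 2 := by
  obtain ⟨hn, m, hm, hmax⟩ := hv
  have hq : v.ofLp ⬝ᵥ A *ᵥ v.ofLp = m := by
    have h : A *ᵥ v.ofLp = m • v.ofLp := by
      have := congrArg WithLp.ofLp hm
      simpa [Matrix.toLpLin_apply] using this
    rw [h, dotProduct_smul, ← inner_eq_dotProduct, real_inner_self_eq_norm_sq, hn]
    simp
  rw [hq, dotProduct_mulVec_self_eq_sum hA, ← hA.eigenvectorBasis.sum_sq_inner_right x,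
    Finset.mul_sum]
  exact Finset.sum_le_sum fun i _ =>
    mul_le_mul_of_nonneg_right (hmax _ (hasEigenvalue_eigenvalues hA i)) (sq_nonneg _)

/-- With a gap between the two largest eigenvalues, the quadratic form is controlled by the
component along a leading eigenvector. -/
theorem IsLeadingEigenvector.spectral_gap {A : Matrix (Fin p) (Fin p) ℝ} (hA : A.IsHermitian)
    (hp : 2 ≤ p) (hgap : eigval hA 1 (by omega) < eigval hA 0 (by omega))
    {u : EuclideanSpace ℝ (Fin p)} (hu : IsLeadingEigenvector A u) :
    A *ᵥ u.ofLp = eigval hA 0 (by omega) • u.ofLp ∧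
    ∀ x : EuclideanSpace ℝ (Fin p), x.ofLp ⬝ᵥ A *ᵥ x.ofLp ≤
      eigval hA 0 (by omega) * inner ℝ u x ^ 2
        + eigval hA 1 (by omega) * (‖x‖ ^ 2 - inner ℝ u x ^ 2) := by
  -- `eigenvalues` is the sorted list `eigenvalues₀` reindexed by `e`, so `i₀` carries the largest
  -- eigenvalue and every other index has sorted position at least `1`.
  set e : Fin (Fintype.card (Fin p)) ≃ Fin p := Fintype.equivOfCardEq (Fintype.card_fin _)
  set i₀ : Fin p := e ⟨0, by simp; omega⟩ with hi₀
  set Λ₁ := eigval hA 0 (by omega) with hΛ₁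
  set Λ₂ := eigval hA 1 (by omega) with hΛ₂
  have ev0 : hA.eigenvalues i₀ = Λ₁ := by
    simp only [hi₀, IsHermitian.eigenvalues, e, Equiv.symm_apply_apply]
    rfl
  have evne : ∀ i, i ≠ i₀ → hA.eigenvalues i ≤ Λ₂ := by
    intro i hi
    apply hA.eigenvalues₀_antitone
    rw [Fin.le_def]
    change 1 ≤ (e.symm i).val
    by_contra hlt
    apply hi
    rw [hi₀, ← e.symm_apply_eq]
    ext
    simp only
    omega
  have hle : ∀ i, hA.eigenvalues i ≤ Λ₁ := fun i => by
    by_cases h : i = i₀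
    · rw [h, ev0]
    · exact (evne i h).trans hgap.le
  obtain ⟨hn, m, hm, hmax⟩ := hu
  have hmv : A *ᵥ u.ofLp = m • u.ofLp := by
    have := congrArg WithLp.ofLp hm
    simpa [Matrix.toLpLin_apply] using this
  -- Eigenvectors for distinct eigenvalues are orthogonal; since `Λ₁` is simple, `u` is `±` the
  -- basis vector at `i₀`.
  have hcoef : ∀ i, (hA.eigenvalues i - m) * inner ℝ (hA.eigenvectorBasis i) u = 0 := by
    intro i
    have h1 : (hA.eigenvectorBasis i).ofLp ⬝ᵥ A *ᵥ u.ofLp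
        = m * inner ℝ (hA.eigenvectorBasis i) u := by
      rw [hmv, dotProduct_smul, inner_eq_dotProduct, smul_eq_mul]
    rw [dotProduct_mulVec_comm_of_isHermitian hA,
      IsHermitian.mulVec_eigenvectorBasis, smul_dotProduct, ← inner_eq_dotProduct, smul_eq_mul] at h1
    linarith
  have hmΛ : Λ₁ ≤ m := ev0 ▸ hmax _ (hasEigenvalue_eigenvalues hA i₀)
  have hzero : ∀ i, i ≠ i₀ → inner ℝ (hA.eigenvectorBasis i) u = 0 := by
    intro i hi
    rcases mul_eq_zero.1 (hcoef i) with h | h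
    · have := evne i hi
      linarith
    · exact h
  set c : ℝ := inner ℝ (hA.eigenvectorBasis i₀) u with hc
  have hc2 : c ^ 2 = 1 := by
    have h := hA.eigenvectorBasis.sum_sq_inner_right u
    rw [hn, Finset.sum_eq_single i₀ (fun i _ hi => by rw [hzero i hi]; simp) (by simp)] at h
    simpa using h
  have hmeq : m = Λ₁ := by
    rcases mul_eq_zero.1 (hcoef i₀) with h | h
    · rw [ev0] at h
      linarith
    · rw [← hc] at h
      rw [h] at hc2
      norm_num at hc2
  refine ⟨by rw [hmv, hmeq], fun x => ?_⟩
  have hux : inner ℝ u x ^ 2 = inner ℝ (hA.eigenvectorBasis i₀) x ^ 2 := by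
    rw [← hA.eigenvectorBasis.sum_inner_mul_inner u x,
      Finset.sum_eq_single i₀ (fun i _ hi => by
        rw [real_inner_comm, hzero i hi, zero_mul]) (by simp), real_inner_comm, mul_pow,
      ← hc, hc2, one_mul]
  rw [hux, dotProduct_mulVec_self_eq_sum hA, ← hA.eigenvectorBasis.sum_sq_inner_right x,
    ← Finset.add_sum_erase _ _ (Finset.mem_univ i₀),
    ← Finset.add_sum_erase (a := i₀) _ (fun i => inner ℝ (hA.eigenvectorBasis i) x ^ 2)
      (Finset.mem_univ i₀), ev0, add_sub_cancel_left, Finset.mul_sum]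
  gcongr with i hi
  exact evne i (Finset.ne_of_mem_erase hi)

/-- A domination of quadratic forms gives a domination of traces against a positive
semidefinite matrix. -/
theorem trace_mul_le_of_dotProduct_mulVec_le {A B F : Matrix (Fin p) (Fin p) ℝ}
    (hF : F.PosSemidef) (h : ∀ x : Fin p → ℝ, x ⬝ᵥ A *ᵥ x ≤ x ⬝ᵥ B *ᵥ x) :
    (A * F).trace ≤ (B * F).trace := by
  -- With `F = Rᵀ R` the trace is a sum of quadratic forms over the rows of `R`.
  obtain ⟨R, rfl⟩ : ∃ R : Matrix (Fin p) (Fin p) ℝ, F = Rᵀ * R := by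
    open scoped MatrixOrder in
    have := CStarAlgebra.nonneg_iff_eq_star_mul_self.1 (Matrix.nonneg_iff_posSemidef.2 hF)
    simpa [Matrix.star_eq_conjTranspose] using this
  have key : ∀ M : Matrix (Fin p) (Fin p) ℝ,
      (M * (Rᵀ * R)).trace = ∑ k, R k ⬝ᵥ M *ᵥ R k := by
    intro M
    rw [← Matrix.mul_assoc, trace_mul_comm, ← Matrix.mul_assoc]
    simp only [trace, diag, Matrix.mul_assoc]
    refine Finset.sum_congr rfl fun k _ => ?_
    simp [Matrix.mul_apply, dotProduct, mulVec, Matrix.transpose_apply]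
  rw [key, key]
  exact Finset.sum_le_sum fun k _ => h _

/-- The squared Frobenius norm. -/
def frobSq (A : Matrix (Fin p) (Fin p) ℝ) : ℝ := ∑ j, ∑ k, A j k ^ 2

theorem frobSq_nonneg (A : Matrix (Fin p) (Fin p) ℝ) : 0 ≤ frobSq A :=
  Finset.sum_nonneg fun _ _ => Finset.sum_nonneg fun _ _ => sq_nonneg _

theorem trace_mul_eq_sum (A B : Matrix (Fin p) (Fin p) ℝ) :
    (A * B).trace = ∑ j, ∑ k, A j k * B k j := by
  simp [trace, Matrix.mul_apply]

theorem trace_mul_vecMulVec (A : Matrix (Fin p) (Fin p) ℝ) (u v : Fin p → ℝ) :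
    (A * vecMulVec u v).trace = v ⬝ᵥ A *ᵥ u := by
  rw [mul_vecMulVec, trace_vecMulVec, dotProduct_comm]

theorem apply_comm_of_isHermitian {A : Matrix (Fin p) (Fin p) ℝ} (hA : A.IsHermitian)
    (j k : Fin p) : A j k = A k j := by
  simpa using (hA.apply j k).symm

theorem trace_mul_self_eq_frobSq {A : Matrix (Fin p) (Fin p) ℝ} (hA : A.IsHermitian) :
    (A * A).trace = frobSq A := by
  rw [trace_mul_eq_sum, frobSq]
  refine Finset.sum_congr rfl fun j _ => Finset.sum_congr rfl fun k _ => ?_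
  rw [apply_comm_of_isHermitian hA k j, sq]

theorem vecMulVec_self_isHermitian (u : Fin p → ℝ) : (vecMulVec u u).IsHermitian := by
  ext j k
  simp [vecMulVec, mul_comm]

/-- Expand the square: `F ⪯ I` gives `tr F² ≤ tr F = 1`, and `u uᵀ` has Frobenius norm `1`. -/
theorem frobSq_sub_vecMulVec_le {F : Matrix (Fin p) (Fin p) ℝ} (hF : F ∈ fantope p)
    {u : Fin p → ℝ} (hu : u ⬝ᵥ u = 1) :
    frobSq (F - vecMulVec u u) ≤ 2 * (1 - u ⬝ᵥ F *ᵥ u) := by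
  obtain ⟨htr, hpsd, hle⟩ := hF
  rw [← trace_mul_self_eq_frobSq (hpsd.isHermitian.sub (vecMulVec_self_isHermitian u))]
  have h1 : (F * F).trace ≤ (1 * F).trace := by
    refine trace_mul_le_of_dotProduct_mulVec_le hpsd fun x => ?_
    have := hle.dotProduct_mulVec_nonneg x
    simp only [star_trivial, sub_mulVec, dotProduct_sub] at this
    linarith
  rw [one_mul, htr] at h1
  have h2 : (F * vecMulVec u u).trace = u ⬝ᵥ F *ᵥ u := trace_mul_vecMulVec _ _ _
  have h3 : (vecMulVec u u * F).trace = u ⬝ᵥ F *ᵥ u := by rw [trace_mul_comm, h2]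
  have h4 : (vecMulVec u u * vecMulVec u u).trace = 1 := by
    rw [trace_mul_vecMulVec, vecMulVec_mulVec, hu]
    simp [hu]
  rw [sub_mul, mul_sub, mul_sub, trace_sub, trace_sub, trace_sub, h2, h3, h4]
  linarith

/-- The hypothesis says `A ⪯ Λ₂ I + (Λ₁ - Λ₂) u uᵀ`; pair it with `F`. Together with
`frobSq_sub_vecMulVec_le` this is the curvature of the objective. -/
theorem trace_mul_le_of_gap {A F : Matrix (Fin p) (Fin p) ℝ} (hF : F ∈ fantope p)
    {u : EuclideanSpace ℝ (Fin p)} {Λ₁ Λ₂ : ℝ}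
    (h : ∀ x : EuclideanSpace ℝ (Fin p), x.ofLp ⬝ᵥ A *ᵥ x.ofLp ≤
      Λ₁ * inner ℝ u x ^ 2 + Λ₂ * (‖x‖ ^ 2 - inner ℝ u x ^ 2)) :
    (A * F).trace ≤ Λ₂ + (Λ₁ - Λ₂) * (u.ofLp ⬝ᵥ F *ᵥ u.ofLp) := by
  have key := trace_mul_le_of_dotProduct_mulVec_le (A := A)
    (B := Λ₂ • 1 + (Λ₁ - Λ₂) • vecMulVec u.ofLp u.ofLp) hF.2.1 fun x => by
      refine (h (WithLp.toLp 2 x)).trans (le_of_eq ?_)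
      rw [← real_inner_self_eq_norm_sq, inner_eq_dotProduct, inner_eq_dotProduct]
      simp only [add_mulVec, smul_mulVec, one_mulVec, dotProduct_add, dotProduct_smul,
        vecMulVec_mulVec, smul_eq_mul, op_smul_eq_smul]
      rw [dotProduct_comm x u.ofLp]
      ring
  refine key.trans (le_of_eq ?_)
  rw [add_mul, trace_add, smul_mul_assoc, smul_mul_assoc, trace_smul, trace_smul, one_mul,
    hF.1, trace_mul_comm, trace_mul_vecMulVec]
  simp

theorem vecMulVec_self_mem_fantope {u : EuclideanSpace ℝ (Fin p)} (hu : ‖u‖ = 1) :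
    vecMulVec u.ofLp u.ofLp ∈ fantope p := by
  have huu : u.ofLp ⬝ᵥ u.ofLp = 1 := by
    rw [← inner_eq_dotProduct, real_inner_self_eq_norm_sq, hu, one_pow]
  refine ⟨by rw [trace_vecMulVec, huu], ?_, ?_⟩
  · simpa using posSemidef_vecMulVec_self_star u.ofLp
  · refine PosSemidef.of_dotProduct_mulVec_nonneg
      (isHermitian_one.sub (vecMulVec_self_isHermitian _)) fun x => ?_
    have h := real_inner_mul_inner_self_le u (WithLp.toLp 2 x)
    rw [real_inner_self_eq_norm_sq, hu, inner_eq_dotProduct, inner_eq_dotProduct] at h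
    simp only [star_trivial, sub_mulVec, one_mulVec, vecMulVec_mulVec, dotProduct_sub,
      op_smul_eq_smul, dotProduct_smul, smul_eq_mul]
    rw [dotProduct_comm x u.ofLp]
    simp only at h
    linarith

/-- Duality of the entrywise sup and `ℓ₁` norms, which puts the noise on the scale of the penalty.
-/
theorem abs_trace_mul_le {A F : Matrix (Fin p) (Fin p) ℝ} {c : ℝ} (hA : ∀ j k, |A j k| ≤ c) :
    |(A * F).trace| ≤ c * entryL1 F := by
  rw [trace_mul_eq_sum, entryL1, Finset.sum_comm, Finset.mul_sum]
  refine (Finset.abs_sum_le_sum_abs _ _).trans (Finset.sum_le_sum fun j _ => ?_)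
  rw [Finset.mul_sum]
  refine (Finset.abs_sum_le_sum_abs _ _).trans (Finset.sum_le_sum fun k _ => ?_)
  rw [abs_mul]
  exact mul_le_mul_of_nonneg_right (hA _ _) (abs_nonneg _)

theorem entryL1_add_le (A B : Matrix (Fin p) (Fin p) ℝ) :
    entryL1 (A + B) ≤ entryL1 A + entryL1 B := by
  simp only [entryL1, ← Finset.sum_add_distrib]
  exact Finset.sum_le_sum fun j _ => Finset.sum_le_sum fun k _ => abs_add_le _ _

/-- The restriction of a matrix to the entries with both indices in `T`. -/
def restrictTo (T : Finset (Fin p)) (A : Matrix (Fin p) (Fin p) ℝ) :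
    Matrix (Fin p) (Fin p) ℝ :=
  Matrix.of fun j k => if j ∈ T ∧ k ∈ T then A j k else 0

theorem entryL1_eq_restrictTo_add (T : Finset (Fin p)) (A : Matrix (Fin p) (Fin p) ℝ) :
    entryL1 A = entryL1 (restrictTo T A) + entryL1 (A - restrictTo T A) := by
  simp only [entryL1, ← Finset.sum_add_distrib]
  refine Finset.sum_congr rfl fun j _ => Finset.sum_congr rfl fun k _ => ?_
  by_cases h : j ∈ T ∧ k ∈ T <;> simp [restrictTo, h]

theorem entryL1_nonneg (A : Matrix (Fin p) (Fin p) ℝ) : 0 ≤ entryL1 A :=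
  Finset.sum_nonneg fun _ _ => Finset.sum_nonneg fun _ _ => abs_nonneg _

/-- Cauchy–Schwarz over the `|T|²` entries of the block; this is where sparsity enters. -/
theorem entryL1_restrictTo_le (T : Finset (Fin p)) (A : Matrix (Fin p) (Fin p) ℝ) :
    entryL1 (restrictTo T A) ≤ T.card * Real.sqrt (frobSq A) := by
  have h1 : entryL1 (restrictTo T A) = ∑ q ∈ T ×ˢ T, |A q.1 q.2| := by
    rw [Finset.sum_product, entryL1, ← Finset.sum_subset (Finset.subset_univ T)]
    · refine Finset.sum_congr rfl fun j hj => ?_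
      rw [← Finset.sum_subset (Finset.subset_univ T)]
      · exact Finset.sum_congr rfl fun k hk => by simp [restrictTo, hj, hk]
      · intro k _ hk
        simp [restrictTo, hk]
    · intro j _ hj
      simp [restrictTo, hj]
  have h2 : (∑ q ∈ T ×ˢ T, |A q.1 q.2|) ^ 2 ≤ (T.card : ℝ) ^ 2 * frobSq A := by
    refine (sq_sum_le_card_mul_sum_sq (s := T ×ˢ T)).trans ?_
    rw [Finset.card_product, Nat.cast_mul, ← sq]
    refine mul_le_mul_of_nonneg_left ?_ (sq_nonneg _)
    simp only [sq_abs, frobSq]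
    rw [← Finset.sum_product']
    exact Finset.sum_le_sum_of_subset_of_nonneg (Finset.subset_univ _)
      fun _ _ _ => sq_nonneg _
  rw [h1]
  refine (Real.le_sqrt_of_sq_le h2).trans (le_of_eq ?_)
  rw [Real.sqrt_mul (sq_nonneg _), Real.sqrt_sq (Nat.cast_nonneg _)]

/-- Cauchy–Schwarz for the Frobenius product of `A` with `x xᵀ`, which has norm `1`. -/
theorem abs_dotProduct_mulVec_le {A : Matrix (Fin p) (Fin p) ℝ}
    {x : Fin p → ℝ} (hx : x ⬝ᵥ x = 1) :
    |x ⬝ᵥ A *ᵥ x| ≤ Real.sqrt (frobSq A) := by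
  refine Real.abs_le_sqrt ?_
  have h1 : x ⬝ᵥ A *ᵥ x = ∑ q : Fin p × Fin p, A q.1 q.2 * (x q.1 * x q.2) := by
    rw [Fintype.sum_prod_type]
    simp only [dotProduct, mulVec, Finset.mul_sum]
    exact Finset.sum_congr rfl fun j _ => Finset.sum_congr rfl fun k _ => by ring
  have h2 : ∑ q : Fin p × Fin p, (x q.1 * x q.2) ^ 2 = 1 := by
    rw [Fintype.sum_prod_type]
    have : ∑ i, x i ^ 2 = 1 := by simpa [dotProduct, sq] using hx
    simp only [mul_pow, ← Finset.mul_sum, this, mul_one]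
  have h3 : ∑ q : Fin p × Fin p, A q.1 q.2 ^ 2 = frobSq A := by
    rw [Fintype.sum_prod_type, frobSq]
  rw [h1]
  refine (Finset.sum_mul_sq_le_sq_mul_sq _ _ _).trans ?_
  rw [h2, h3, mul_one]

/-- A leading eigenvector of a matrix close to `u uᵀ` is close to `u`. -/
theorem IsLeadingEigenvector.norm_sub_le {F : Matrix (Fin p) (Fin p) ℝ} (hF : F.IsHermitian)
    {u v : EuclideanSpace ℝ (Fin p)} (hu : ‖u‖ = 1) (hv : IsLeadingEigenvector F v)
    (hpos : 0 ≤ inner ℝ v u) {ε : ℝ}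
    (hε : Real.sqrt (frobSq (F - vecMulVec u.ofLp u.ofLp)) ≤ ε) :
    ‖v - u‖ ≤ 2 * Real.sqrt ε := by
  have huu : u.ofLp ⬝ᵥ u.ofLp = 1 := by
    rw [← inner_eq_dotProduct, real_inner_self_eq_norm_sq, hu, one_pow]
  have hvv : v.ofLp ⬝ᵥ v.ofLp = 1 := by
    rw [← inner_eq_dotProduct, real_inner_self_eq_norm_sq, hv.1, one_pow]
  have h1 := (abs_le.1 ((abs_dotProduct_mulVec_le huu).trans hε)).1
  have h2 := (abs_le.1 ((abs_dotProduct_mulVec_le hvv).trans hε)).2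
  have h3 := hv.dotProduct_mulVec_le hF u
  simp only [sub_mulVec, vecMulVec_mulVec, dotProduct_sub, op_smul_eq_smul, dotProduct_smul,
    smul_eq_mul, huu, mul_one] at h1 h2
  rw [dotProduct_comm u.ofLp v.ofLp, ← inner_eq_dotProduct v u] at h2
  rw [hu, one_pow, mul_one] at h3
  set t := inner ℝ v u
  have ht1 : t ≤ 1 := by
    have := real_inner_le_norm v u
    rwa [hu, hv.1, one_mul] at this
  -- `1 - ε ≤ uᵀFu ≤ vᵀFv ≤ t² + ε`, and `t² ≤ t` on `[0, 1]`, so `2 - 2t ≤ 4ε`.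
  have hn : ‖v - u‖ ^ 2 ≤ 4 * ε := by
    rw [norm_sub_sq_real, hu, hv.1]
    change 1 ^ 2 - 2 * t + 1 ^ 2 ≤ 4 * ε
    nlinarith
  have hε0 : 0 ≤ ε := (Real.sqrt_nonneg _).trans hε
  refine (sq_le_sq₀ (norm_nonneg _) (by positivity)).1 ?_
  rw [mul_pow, Real.sq_sqrt hε0]
  linarith

theorem entryL1_neg (A : Matrix (Fin p) (Fin p) ℝ) : entryL1 (-A) = entryL1 A := by
  simp [entryL1]

theorem restrictTo_vecMulVec_self {T : Finset (Fin p)} {u : Fin p → ℝ}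
    (hT : ∀ j, u j ≠ 0 → j ∈ T) : restrictTo T (vecMulVec u u) = vecMulVec u u := by
  ext j k
  simp only [restrictTo, of_apply, vecMulVec_apply]
  split_ifs with h
  · rfl
  · by_contra hne
    exact h ⟨hT j fun h0 => hne (by simp [h0]), hT k fun h0 => hne (by simp [h0])⟩

theorem restrictTo_sub (T : Finset (Fin p)) (A B : Matrix (Fin p) (Fin p) ℝ) :
    restrictTo T (A - B) = restrictTo T A - restrictTo T B := by
  ext j k
  simp only [restrictTo, of_apply, Matrix.sub_apply]
  split_ifs <;> simp

theorem frobSq_vecMulVec_self {u : Fin p → ℝ} (hu : u ⬝ᵥ u = 1) :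
    frobSq (vecMulVec u u) = 1 := by
  rw [← trace_mul_self_eq_frobSq (vecMulVec_self_isHermitian u), trace_mul_vecMulVec,
    vecMulVec_mulVec, hu]
  simp [hu]

/-- Error bounds for the sparse semidefinite program when the entrywise noise is at most
half the tuning parameter. -/
theorem IsSDPSolution.error_bounds {A S F : Matrix (Fin p) (Fin p) ℝ}
    {u : EuclideanSpace ℝ (Fin p)} (hu : ‖u‖ = 1) {Λ₁ Λ₂ : ℝ} (hgap : Λ₂ < Λ₁)
    (hAu : A *ᵥ u.ofLp = Λ₁ • u.ofLp)
    (hquad : ∀ x : EuclideanSpace ℝ (Fin p), x.ofLp ⬝ᵥ A *ᵥ x.ofLp ≤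
      Λ₁ * inner ℝ u x ^ 2 + Λ₂ * (‖x‖ ^ 2 - inner ℝ u x ^ 2))
    {T : Finset (Fin p)} (hT : ∀ j, u j ≠ 0 → j ∈ T) {s : ℕ} (hs : T.card ≤ s)
    {μ : ℝ} (hμ : 0 ≤ μ) (hdev : ∀ j k, |(S - A) j k| ≤ μ / 2) (hF : IsSDPSolution S μ F) :
    Real.sqrt (frobSq (F - vecMulVec u.ofLp u.ofLp)) ≤ 3 * s * μ / (Λ₁ - Λ₂) ∧
    ∀ ε : ℝ, Real.sqrt (frobSq (F - vecMulVec u.ofLp u.ofLp)) ≤ ε → ε ≤ 1 / 6 →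
      |(S * F).trace - Λ₁| ≤ s * μ := by
  obtain ⟨hFmem, hFmin⟩ := hF
  have huu : u.ofLp ⬝ᵥ u.ofLp = 1 := by
    rw [← inner_eq_dotProduct, real_inner_self_eq_norm_sq, hu, one_pow]
  set E := vecMulVec u.ofLp u.ofLp with hE
  set Δ := F - E with hΔ
  set d := Real.sqrt (frobSq Δ) with hd
  have hd2 : d ^ 2 = frobSq Δ := Real.sq_sqrt (frobSq_nonneg _)
  have hd0 : 0 ≤ d := Real.sqrt_nonneg _
  have hsT : (T.card : ℝ) ≤ s := by exact_mod_cast hs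
  have hER : restrictTo T E = E := restrictTo_vecMulVec_self hT
  have hopt : -(S * F).trace + μ * entryL1 F ≤ -(S * E).trace + μ * entryL1 E :=
    hFmin (vecMulVec_self_mem_fantope hu)
  set a := entryL1 (restrictTo T Δ) with ha
  set b := entryL1 (Δ - restrictTo T Δ) with hb
  have hb0 : 0 ≤ b := entryL1_nonneg _
  have hab : entryL1 Δ = a + b := entryL1_eq_restrictTo_add T Δ
  have had : a ≤ s * d := (entryL1_restrictTo_le T Δ).trans
    (mul_le_mul_of_nonneg_right hsT hd0)
  have hEs : entryL1 E ≤ s := by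
    have := entryL1_restrictTo_le T E
    rw [hER, frobSq_vecMulVec_self huu, Real.sqrt_one, mul_one] at this
    exact this.trans hsT
  have hFlow : entryL1 E - a + b ≤ entryL1 F := by
    have h1 := entryL1_eq_restrictTo_add T F
    have h3 : F - restrictTo T F = Δ - restrictTo T Δ := by
      rw [hΔ, restrictTo_sub, hER]
      abel
    have h4 : entryL1 E ≤ entryL1 (restrictTo T F) + a := by
      rw [ha, ← entryL1_neg (restrictTo T Δ)]
      refine le_trans (le_of_eq ?_) (entryL1_add_le _ _)
      rw [hΔ, restrictTo_sub, hER]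
      congr 1
      abel
    rw [h3] at h1
    linarith
  have hFup : entryL1 F ≤ entryL1 E + (a + b) := by
    have h := entryL1_add_le E Δ
    rw [hab, hΔ, add_sub_cancel] at h
    exact h
  have hAE : (A * E).trace = Λ₁ := by
    rw [trace_mul_vecMulVec, hAu, dotProduct_smul, huu, smul_eq_mul, mul_one]
  have hcurv := trace_mul_le_of_gap hFmem hquad
  have hfro := frobSq_sub_vecMulVec_le hFmem huu
  have hf : frobSq (F - vecMulVec u.ofLp u.ofLp) = frobSq Δ := rfl
  rw [hf, ← hd2] at hfro
  have hnoise := abs_le.1 (abs_trace_mul_le (F := Δ) hdev)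
  have hnoiseE := abs_le.1 (abs_trace_mul_le (F := E) hdev)
  have hnoiseF := abs_le.1 (abs_trace_mul_le (F := F) hdev)
  simp only [sub_mul, trace_sub] at hnoise hnoiseE hnoiseF
  have hSΔ : (S * Δ).trace = (S * F).trace - (S * E).trace := by
    rw [hΔ, mul_sub, trace_sub]
  have hAΔ : (A * Δ).trace = (A * F).trace - (A * E).trace := by
    rw [hΔ, mul_sub, trace_sub]
  rw [hSΔ, hAΔ, hab] at hnoise
  have hg : 0 < Λ₁ - Λ₂ := by linarith
  have hfrog := mul_le_mul_of_nonneg_left hfro hg.le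
  have hμlow := mul_le_mul_of_nonneg_left hFlow hμ
  -- Curvature is at most the penalty difference `μ (a - b)` plus the noise `μ / 2 * (a + b)`. In
  -- particular `μ b ≤ 3 μ a`.
  have hbasic : (Λ₁ - Λ₂) / 2 * d ^ 2 ≤ 3 / 2 * (μ * a) - 1 / 2 * (μ * b) := by
    rw [hAE] at hnoise
    linarith [hnoise.2]
  have hμa : μ * a ≤ μ * (s * d) := mul_le_mul_of_nonneg_left had hμ
  have hμb0 : 0 ≤ μ * b := mul_nonneg hμ hb0
  have hgd : 0 ≤ (Λ₁ - Λ₂) / 2 * d ^ 2 := by positivity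
  refine ⟨?_, fun ε hdε hε => ?_⟩
  · rw [le_div_iff₀ hg]
    rcases hd0.eq_or_lt with h0 | h0
    · rw [← h0]
      simp only [zero_mul]
      positivity
    · have : (d * (Λ₁ - Λ₂)) * d ≤ (3 * s * μ) * d := by linarith
      exact le_of_mul_le_mul_right this h0
  · have hμd : μ * (s * d) ≤ μ * (s * (1 / 6)) := by gcongr; linarith
    have hμE : μ * entryL1 E ≤ μ * s := mul_le_mul_of_nonneg_left hEs hμ
    have hμF := mul_le_mul_of_nonneg_left hFup hμ
    have hμs : 0 ≤ μ * s := by positivity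
    rw [hAE] at hnoiseE
    have hAF : (A * F).trace ≤ Λ₁ := by
      have h5 : 0 ≤ d ^ 2 := sq_nonneg d
      have h6 : 0 ≤ (Λ₁ - Λ₂) * (2 * (1 - u.ofLp ⬝ᵥ F *ᵥ u.ofLp)) :=
        mul_nonneg hg.le (h5.trans hfro)
      linarith
    rw [abs_le]
    constructor
    -- Lower bound from optimality against `E`: the loss is at most `μ s / 2 + μ s d`.
    · linarith [hnoiseE.1]
    -- Upper bound from `tr (A F) ≤ Λ₁`: the excess is at most `μ / 2 * (s + 4 s d)`, using `μ b ≤ 3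
    -- μ a`; `d ≤ 1 / 6` suffices.
    · linarith [hnoiseF.2]

/-- Multiply by the conjugate `√a + √b`; both `a` and `b` are at least `b - c`. -/
theorem abs_sqrt_sub_sqrt_le {a b c : ℝ} (hb : |a - b| ≤ c) (hc : c < b) :
    |Real.sqrt a - Real.sqrt b| ≤ 1 / (2 * Real.sqrt (b - c)) * c := by
  have hc0 : 0 ≤ c := (abs_nonneg _).trans hb
  have h := (abs_le.1 hb).1
  have hbc : 0 < b - c := by linarith
  have hr : 0 < Real.sqrt (b - c) := Real.sqrt_pos.2 hbc
  have h1 : Real.sqrt (b - c) ≤ Real.sqrt a := Real.sqrt_le_sqrt (by linarith)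
  have h2 : Real.sqrt (b - c) ≤ Real.sqrt b := Real.sqrt_le_sqrt (by linarith)
  have h3 : |Real.sqrt a - Real.sqrt b| * (Real.sqrt a + Real.sqrt b) = |a - b| := by
    rw [← abs_of_nonneg (add_nonneg (Real.sqrt_nonneg a) (Real.sqrt_nonneg b)), ← abs_mul]
    congr 1
    have ha := Real.mul_self_sqrt (show 0 ≤ a by linarith)
    have hb := Real.mul_self_sqrt (show 0 ≤ b by linarith)
    linear_combination ha - hb
  rw [one_div, ← div_eq_inv_mul, le_div_iff₀ (by positivity)]
  calc _ ≤ |Real.sqrt a - Real.sqrt b| * (Real.sqrt a + Real.sqrt b) := by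
        gcongr
        linarith
    _ ≤ c := h3.trans_le hb

/-- The error bound for the initial estimator on the event that the entrywise noise is at most
half the tuning parameter. -/
theorem norm_betaInit_sub_le {A S F : Matrix (Fin p) (Fin p) ℝ} (hA : A.IsHermitian)
    (hp : 2 ≤ p) {Λ₁ Λ₂ : ℝ} (hΛ₁ : Λ₁ = eigval hA 0 (by omega))
    (hΛ₂ : Λ₂ = eigval hA 1 (by omega)) (hgap : Λ₂ < Λ₁) (hΛ₁pos : 0 < Λ₁)
    {u β v : EuclideanSpace ℝ (Fin p)} (hu : IsLeadingEigenvector A u)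
    (hβ : β = Real.sqrt Λ₁ • u) {s : ℕ}
    (hs : (Finset.univ.filter (fun j => β j ≠ 0)).card ≤ s) {μ ε α : ℝ} (hμ : 0 ≤ μ)
    (hε : ε = epsilon 4 s μ Λ₁ Λ₂) (hα : α = alpha s μ ε ‖β‖) (hαΛ : α < Λ₁)
    (hdev : ∀ j k, |(S - A) j k| ≤ μ / 2) (hF : IsSDPSolution S μ F)
    (hv : IsLeadingEigenvector F v) (hvu : 0 ≤ inner ℝ v u) :
    ‖betaInit S F v - β‖
      ≤ 1 / (2 * Real.sqrt (Λ₁ - α)) * α + 2 * Real.sqrt ε * Real.sqrt Λ₁ := by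
  obtain ⟨hAu, hquad⟩ := hu.spectral_gap hA hp (hΛ₁ ▸ hΛ₂ ▸ hgap)
  rw [← hΛ₁] at hAu
  simp only [← hΛ₁, ← hΛ₂] at hquad
  have hr : 0 < Real.sqrt Λ₁ := Real.sqrt_pos.2 hΛ₁pos
  have hg : 0 < Λ₁ - Λ₂ := by linarith
  obtain ⟨hd, htr⟩ := hF.error_bounds hu.1 hgap hAu hquad
    (T := Finset.univ.filter (fun j => β j ≠ 0)) (fun j hj => by
      simp only [Finset.mem_filter, Finset.mem_univ, true_and, hβ]
      exact mul_ne_zero hr.ne' hj) hs hμ hdev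
  have hε' : ε = 4 * s * μ / (Λ₁ - Λ₂) := by
    rw [hε, epsilon, show 4 * 4 * (s : ℝ) ^ 2 * μ ^ 2 / (Λ₁ - Λ₂) ^ 2
      = (4 * s * μ / (Λ₁ - Λ₂)) ^ 2 by rw [div_pow]; ring, Real.sqrt_sq (by positivity)]
  have hε0 : 0 ≤ ε := by rw [hε']; positivity
  have hdε : Real.sqrt (frobSq (F - vecMulVec u.ofLp u.ofLp)) ≤ ε := by
    refine hd.trans ?_
    rw [hε']
    gcongr
    norm_num
  have hβn : ‖β‖ ^ 2 = Λ₁ := by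
    rw [hβ, norm_smul, hu.1, mul_one, Real.norm_eq_abs, sq_abs, Real.sq_sqrt hΛ₁pos.le]
  have hsμ : 0 ≤ s * μ := by positivity
  have h4 : 0 ≤ 4 * ‖β‖ * Real.sqrt ε := by positivity
  have h6 : 0 ≤ 6 * Λ₁ * ε := by positivity
  rw [alpha, hβn] at hα
  -- The term `6 ‖β⁰‖² ε = 6 Λ₁ ε` of `α` and `α < Λ₁` force this.
  have hε6 : ε ≤ 1 / 6 := by
    have : Λ₁ * (6 * ε) ≤ Λ₁ * 1 := by nlinarith [sq_nonneg ε]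
    have := le_of_mul_le_mul_left this hΛ₁pos
    linarith
  have htrα : |(S * F).trace - Λ₁| ≤ α := by
    refine (htr ε hdε hε6).trans ?_
    nlinarith [sq_nonneg ε]
  have htrpos : 0 ≤ (S * F).trace := by
    have := (abs_le.1 htrα).1
    linarith
  have hsplit : betaInit S F v - β
      = (Real.sqrt (S * F).trace - Real.sqrt Λ₁) • v + Real.sqrt Λ₁ • (v - u) := by
    rw [betaInit, abs_of_nonneg htrpos, hβ, sub_smul, smul_sub]
    abel
  rw [hsplit]
  refine (norm_add_le _ _).trans (add_le_add ?_ ?_)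
  · rw [norm_smul, hv.1, mul_one, Real.norm_eq_abs]
    exact abs_sqrt_sub_sqrt_le htrα hαΛ
  · rw [norm_smul, Real.norm_eq_abs, abs_of_pos hr, mul_comm]
    exact mul_le_mul_of_nonneg_right
      (hv.norm_sub_le hF.1.2.1.isHermitian hu.1 hvu hdε) hr.le

end Deterministic

/-! ### Independence of paired families -/

section Independence

variable {Ω ι α β : Type*} [MeasurableSpace Ω] {P : Measure Ω} [IsProbabilityMeasure P]
  [Fintype ι] [MeasurableSpace α] [MeasurableSpace β]

/-- Two independent families, each of them independent, give an independent family of pairs. -/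
theorem iIndepFun_prodMk_of_indepFun {X : ι → Ω → α} {Y : ι → Ω → β}
    (hXm : ∀ i, AEMeasurable (X i) P) (hYm : ∀ i, AEMeasurable (Y i) P)
    (hX : iIndepFun X P) (hY : iIndepFun Y P)
    (hXY : IndepFun (fun ω i => X i ω) (fun ω i => Y i ω) P) :
    iIndepFun (fun i ω => (X i ω, Y i ω)) P := by
  have hXm' : AEMeasurable (fun ω i => X i ω) P := aemeasurable_pi_lambda _ hXm
  have hYm' : AEMeasurable (fun ω i => Y i ω) P := aemeasurable_pi_lambda _ hYm
  have hprod (i : ι) : AEMeasurable (fun ω => (X i ω, Y i ω)) P := (hXm i).prodMk (hYm i)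
  have := fun i => Measure.isProbabilityMeasure_map (hXm i)
  have := fun i => Measure.isProbabilityMeasure_map (hYm i)
  rw [iIndepFun_iff_map_fun_eq_pi_map hprod]
  have hpair (i : ι) : P.map (fun ω => (X i ω, Y i ω)) = (P.map (X i)).prod (P.map (Y i)) :=
    (indepFun_iff_map_prod_eq_prod_map_map (hXm i) (hYm i)).1
      (hXY.comp (measurable_pi_apply i) (measurable_pi_apply i))
  have hjoint := (indepFun_iff_map_prod_eq_prod_map_map hXm' hYm').1 hXY
  -- The joint law is a product of two product measures; regrouping coordinates turns it into a
  -- product of laws of pairs.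
  rw [hX.map_fun_eq_pi_map hXm, hY.map_fun_eq_pi_map hYm] at hjoint
  have hmp := measurePreserving_arrowProdEquivProdArrow α β ι
    (fun i => P.map (X i)) (fun i => P.map (Y i))
  simp_rw [hpair]
  rw [← (hmp.symm _).map_eq, ← hjoint, AEMeasurable.map_map_of_aemeasurable
    (MeasurableEquiv.measurable _).aemeasurable (hXm'.prodMk hYm')]
  rfl

end Independence

/-! ### Moment generating functions and a Bernstein inequality -/

section Chernoff

variable {Ω : Type*} [MeasurableSpace Ω] {P : Measure Ω}

theorem exp_le_one_add_add_sq_mul_exp_abs (x : ℝ) :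
    Real.exp x ≤ 1 + x + x ^ 2 * Real.exp |x| := by
  have h := Complex.norm_exp_sub_sum_le_norm_mul_exp (x : ℂ) 2
  simp only [Finset.sum_range_succ, Finset.sum_range_zero, pow_zero, Nat.factorial, zero_add,
    pow_one, Complex.norm_real, Real.norm_eq_abs, sq_abs] at h
  have h' : |Real.exp x - (1 + x)| ≤ x ^ 2 * Real.exp |x| := by
    rw [← Real.norm_eq_abs, ← Complex.norm_real]
    simpa using h
  linarith [(abs_le.1 h').2]

/-- With `y = |q| / K`, half of `exp y` pays for `y² ≤ 8 exp (y / 2)` and the other half for `exp |t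
q| ≤ exp (y / 2)`. -/
theorem exp_mul_le_of_abs_mul_le {K t q : ℝ} (hK : 0 < K) (ht : |t| * K ≤ 1 / 2) :
    Real.exp (t * q) ≤ 1 + t * q + 8 * t ^ 2 * K ^ 2 * Real.exp (|q| / K) := by
  refine (exp_le_one_add_add_sq_mul_exp_abs _).trans (add_le_add le_rfl ?_)
  set y := |q| / K with hy
  have hy0 : 0 ≤ y := by positivity
  have hq : |q| = y * K := by rw [hy]; field_simp
  have h1 : |t * q| ≤ y / 2 := by
    rw [abs_mul, hq]
    nlinarith
  have h2 : (t * q) ^ 2 = t ^ 2 * K ^ 2 * y ^ 2 := by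
    rw [mul_pow, ← sq_abs q, hq]
    ring
  have h3 : y ^ 2 ≤ 8 * Real.exp (y / 2) := by
    have := Real.quadratic_le_exp_of_nonneg (show 0 ≤ y / 2 by positivity)
    nlinarith
  rw [h2]
  calc t ^ 2 * K ^ 2 * y ^ 2 * Real.exp |t * q|
      ≤ t ^ 2 * K ^ 2 * (8 * Real.exp (y / 2)) * Real.exp (y / 2) := by gcongr
    _ = 8 * t ^ 2 * K ^ 2 * Real.exp y := by
        rw [show Real.exp y = Real.exp (y / 2) * Real.exp (y / 2) by
          rw [← Real.exp_add, add_halves]]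
        ring

theorem integrable_of_integrable_exp_abs_div {Q : Ω → ℝ} (hQ : AEMeasurable Q P) {K : ℝ}
    (hK : 0 < K) (hint : Integrable (fun ω => Real.exp (|Q ω| / K)) P) : Integrable Q P := by
  refine Integrable.mono' (hint.const_mul K) hQ.aestronglyMeasurable (ae_of_all _ fun ω => ?_)
  have h := Real.add_one_le_exp (|Q ω| / K)
  have h2 : |Q ω| = K * (|Q ω| / K) := by field_simp
  rw [Real.norm_eq_abs, h2]
  exact mul_le_mul_of_nonneg_left (by rw [← h2]; linarith) hK.le

theorem integrable_exp_mul_of_abs_mul_le {Q : Ω → ℝ} (hQ : AEMeasurable Q P) {K t : ℝ}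
    (hK : 0 < K) (hint : Integrable (fun ω => Real.exp (|Q ω| / K)) P)
    (ht : |t| * K ≤ 1 / 2) : Integrable (fun ω => Real.exp (t * Q ω)) P := by
  have hm : AEMeasurable (fun ω => Real.exp (t * Q ω)) P := (hQ.const_mul t).exp
  refine Integrable.mono' hint hm.aestronglyMeasurable (ae_of_all _ fun ω => ?_)
  rw [Real.norm_eq_abs, Real.abs_exp, Real.exp_le_exp, le_div_iff₀ hK]
  calc t * Q ω * K ≤ |t * Q ω| * K := by gcongr; exact le_abs_self _
    _ = (|t| * K) * |Q ω| := by rw [abs_mul]; ring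
    _ ≤ 1 * |Q ω| := by gcongr; linarith
    _ = |Q ω| := one_mul _

theorem integral_exp_mul_le [IsProbabilityMeasure P] {Q : Ω → ℝ}
    (hQ : AEMeasurable Q P) {K t : ℝ} (hK : 0 < K)
    (hint : Integrable (fun ω => Real.exp (|Q ω| / K)) P)
    (hle : ∫ ω, Real.exp (|Q ω| / K) ∂P ≤ 2) (ht : |t| * K ≤ 1 / 2) :
    ∫ ω, Real.exp (t * Q ω) ∂P ≤ 1 + t * ∫ ω, Q ω ∂P + 16 * t ^ 2 * K ^ 2 := by
  have hQi := integrable_of_integrable_exp_abs_div hQ hK hint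
  calc ∫ ω, Real.exp (t * Q ω) ∂P
      ≤ ∫ ω, (1 + t * Q ω + 8 * t ^ 2 * K ^ 2 * Real.exp (|Q ω| / K)) ∂P :=
        integral_mono (integrable_exp_mul_of_abs_mul_le hQ hK hint ht)
          (((integrable_const _).add (hQi.const_mul t)).add (hint.const_mul _))
          fun ω => exp_mul_le_of_abs_mul_le hK ht
    _ = 1 + t * ∫ ω, Q ω ∂P + 8 * t ^ 2 * K ^ 2 * ∫ ω, Real.exp (|Q ω| / K) ∂P := by
        have hlin : Integrable (fun ω => 1 + t * Q ω) P :=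
          (integrable_const _).add (hQi.const_mul t)
        rw [integral_add hlin (hint.const_mul _),
          integral_add (integrable_const _) (hQi.const_mul t), integral_const_mul,
          integral_const_mul]
        simp
    _ ≤ 1 + t * ∫ ω, Q ω ∂P + 8 * t ^ 2 * K ^ 2 * 2 := by gcongr
    _ = _ := by ring

/-- The moment generating function of a sub-exponential variable which is observed with
probability `w` and rescaled. -/
theorem mgf_masked_le [IsProbabilityMeasure P] {B Q : Ω → ℝ}
    (hB : AEMeasurable B P) (hQ : AEMeasurable Q P)
    (hBQ : IndepFun B Q P) {K w l : ℝ} (hK : 0 < K) (hw : 0 < w)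
    (hB01 : ∀ᵐ ω ∂P, B ω = 0 ∨ B ω = 1) (hBw : ∫ ω, B ω ∂P = w)
    (hint : Integrable (fun ω => Real.exp (|Q ω| / K)) P)
    (hle : ∫ ω, Real.exp (|Q ω| / K) ∂P ≤ 2) (hl : |l| * (K / w) ≤ 1 / 2) :
    Integrable (fun ω => Real.exp (l * (B ω * Q ω / w))) P ∧
    mgf (fun ω => B ω * Q ω / w) P l
      ≤ Real.exp (l * ∫ ω, Q ω ∂P + 16 * l ^ 2 * (K ^ 2 / w)) := by
  have ht : |l / w| * K ≤ 1 / 2 := by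
    rw [abs_div, abs_of_pos hw, div_mul_eq_mul_div]
    rwa [← mul_div_assoc] at hl
  have hi := integrable_exp_mul_of_abs_mul_le hQ hK hint ht
  set g : ℝ → ℝ := fun q => Real.exp (l / w * q) - 1 with hg
  have hgm : Measurable g := by fun_prop
  have hgi : Integrable (fun ω => g (Q ω)) P := hi.sub (integrable_const _)
  have hBi : Integrable B P := by
    refine Integrable.mono' (integrable_const (1 : ℝ)) hB.aestronglyMeasurable ?_
    filter_upwards [hB01] with ω h
    rcases h with h | h <;> simp [h]
  have hind : IndepFun B (fun ω => g (Q ω)) P := hBQ.comp measurable_id hgm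
  have hBg : Integrable (fun ω => B ω * g (Q ω)) P := hind.integrable_mul hBi hgi
  -- For `B` in `{0, 1}` the exponential is affine in `B`, so its mean factors. The factor `w`
  -- gained makes the variance proxy `K² / w` rather than `K² / w²`.
  have hae : (fun ω => Real.exp (l * (B ω * Q ω / w))) =ᵐ[P] fun ω => 1 + B ω * g (Q ω) := by
    filter_upwards [hB01] with ω h
    rcases h with h | h
    · simp [h]
    · simp only [h, hg, one_mul, add_sub_cancel]
      congr 1
      ring
  refine ⟨((integrable_const _).add hBg).congr hae.symm, ?_⟩
  have hval : mgf (fun ω => B ω * Q ω / w) P l = 1 + w * ∫ ω, g (Q ω) ∂P := by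
    rw [mgf, integral_congr_ae hae, integral_add (integrable_const _) hBg,
      hind.integral_fun_mul_eq_mul_integral hB.aestronglyMeasurable
        hgi.aestronglyMeasurable, hBw]
    simp
  have hgle : ∫ ω, g (Q ω) ∂P ≤ l / w * ∫ ω, Q ω ∂P + 16 * (l / w) ^ 2 * K ^ 2 := by
    have := integral_exp_mul_le hQ hK hint hle ht
    rw [hg, integral_sub hi (integrable_const _)]
    simp only [integral_const, probReal_univ, smul_eq_mul, one_mul]
    linarith
  rw [hval]
  calc 1 + w * ∫ ω, g (Q ω) ∂P
      ≤ 1 + w * (l / w * ∫ ω, Q ω ∂P + 16 * (l / w) ^ 2 * K ^ 2) := by gcongr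
    _ = (l * ∫ ω, Q ω ∂P + 16 * l ^ 2 * (K ^ 2 / w)) + 1 := by
        field_simp
        ring
    _ ≤ _ := Real.add_one_le_exp _

/-- A choice of the exponent in the Chernoff bound. -/
theorem exists_chernoff_exponent {v b τ a N : ℝ} (hv : 0 < v) (hb : 0 < b) (hτ : 0 < τ)
    (hN : 0 < N) (ha₁ : 34 * Real.sqrt (v * τ / N) ≤ a) (ha₂ : 34 * (b * τ / N) ≤ a) :
    ∃ l : ℝ, 0 ≤ l ∧ l * b ≤ 1 / 2 ∧ -(l * (N * a)) + N * (16 * l ^ 2 * v) ≤ -τ := by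
  set r := Real.sqrt (τ / (N * v)) with hr
  have hr0 : 0 < r := Real.sqrt_pos.2 (by positivity)
  have hr2 : N * v * r ^ 2 = τ := by
    rw [hr, Real.sq_sqrt (by positivity)]
    field_simp
  have hrv : Real.sqrt (v * τ / N) = v * r := by
    rw [hr, ← Real.sqrt_sq hv.le, ← Real.sqrt_mul (sq_nonneg _), Real.sqrt_sq hv.le]
    congr 1
    field_simp
  -- The exponent is `min r (1 / (2b))`. Here `34 = 2 * 17`: when `l = 1 / (2b)` the linear term is
  -- at least `17 τ` and the quadratic one at most `16 τ`.
  by_cases h : r * b ≤ 1 / 2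
  · refine ⟨r, hr0.le, h, ?_⟩
    rw [hrv] at ha₁
    have : r * N * (34 * (v * r)) ≤ r * N * a := by gcongr
    nlinarith
  · have h' : 1 / (2 * b) ≤ r := by
      rw [div_le_iff₀ (by positivity)]
      linarith
    refine ⟨1 / (2 * b), by positivity, le_of_eq (by field_simp), ?_⟩
    have h1 : N * (16 * (1 / (2 * b)) ^ 2 * v) ≤ 16 * τ := by
      calc N * (16 * (1 / (2 * b)) ^ 2 * v) ≤ N * (16 * r ^ 2 * v) := by gcongr
        _ = 16 * τ := by rw [← hr2]; ring
    have h2 : 17 * τ ≤ 1 / (2 * b) * (N * a) := by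
      calc 17 * τ = 1 / (2 * b) * (N * (34 * (b * τ / N))) := by field_simp; ring
        _ ≤ _ := by gcongr
    linarith

/-- A Bernstein inequality for independent variables with a common bound on their moment
generating functions near zero. -/
theorem measureReal_le_abs_sum_sub_le [IsProbabilityMeasure P] {n : ℕ} (hn : 1 ≤ n)
    {Z : Fin n → Ω → ℝ}
    (hZm : ∀ i, AEMeasurable (Z i) P) (hZ : iIndepFun Z P) {m v b τ a : ℝ}
    (hv : 0 < v) (hb : 0 < b) (hτ : 0 < τ)
    (hmgf : ∀ i, ∀ l : ℝ, |l| * b ≤ 1 / 2 → Integrable (fun ω => Real.exp (l * Z i ω)) P ∧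
      mgf (Z i) P l ≤ Real.exp (l * m + 16 * l ^ 2 * v))
    (ha₁ : 34 * Real.sqrt (v * τ / n) ≤ a) (ha₂ : 34 * (b * τ / n) ≤ a) :
    P.real {ω | a ≤ |1 / (n : ℝ) * ∑ i, Z i ω - m|} ≤ 2 * Real.exp (-τ) := by
  have hN : (0 : ℝ) < n := by exact_mod_cast hn
  obtain ⟨l, hl0, hlb, hl⟩ := exists_chernoff_exponent hv hb hτ hN ha₁ ha₂
  have hsum : ∀ t : ℝ, |t| * b ≤ 1 / 2 →
      Integrable (fun ω => Real.exp (t * (∑ i, Z i) ω)) P ∧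
      mgf (∑ i, Z i) P t ≤ Real.exp (n * (t * m + 16 * t ^ 2 * v)) := by
    intro t ht
    have hprod := hZ.mgf_sum₀ (t := t) hZm Finset.univ
    constructor
    -- A non-integrable exponential would give `mgf` its default value `0`, but the product of the
    -- factors is positive.
    · by_contra hni
      have h0 : mgf (∑ i, Z i) P t = 0 := mgf_undef hni
      rw [hprod] at h0
      exact (Finset.prod_pos fun i _ => mgf_pos (hmgf i t ht).1).ne' h0
    · rw [hprod]
      refine (Finset.prod_le_prod (fun i _ => mgf_nonneg) fun i _ => (hmgf i t ht).2).trans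
        (le_of_eq ?_)
      rw [Finset.prod_const, Finset.card_univ, Fintype.card_fin, ← Real.exp_nat_mul]
  have hup : P.real {ω | n * (m + a) ≤ (∑ i, Z i) ω} ≤ Real.exp (-τ) := by
    obtain ⟨hi, hm⟩ := hsum l (by rwa [abs_of_nonneg hl0])
    refine (measure_ge_le_exp_mul_mgf _ hl0 hi).trans ?_
    refine (mul_le_mul_of_nonneg_left hm (Real.exp_pos _).le).trans ?_
    rw [← Real.exp_add, Real.exp_le_exp]
    linarith
  have hlow : P.real {ω | (∑ i, Z i) ω ≤ n * (m - a)} ≤ Real.exp (-τ) := by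
    obtain ⟨hi, hm⟩ := hsum (-l) (by rwa [abs_neg, abs_of_nonneg hl0])
    refine (measure_le_le_exp_mul_mgf _ (neg_nonpos.2 hl0) hi).trans ?_
    refine (mul_le_mul_of_nonneg_left hm (Real.exp_pos _).le).trans ?_
    rw [← Real.exp_add, Real.exp_le_exp]
    linarith
  have hsub : {ω | a ≤ |1 / (n : ℝ) * ∑ i, Z i ω - m|}
      ⊆ {ω | n * (m + a) ≤ (∑ i, Z i) ω} ∪ {ω | (∑ i, Z i) ω ≤ n * (m - a)} := by
    intro ω hω
    simp only [Set.mem_ofPred_eq, Set.mem_union, Finset.sum_apply] at hω ⊢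
    rcases le_abs.1 hω with h | h
    · left
      have h1 : m + a ≤ 1 / (n : ℝ) * ∑ i, Z i ω := by linarith
      rwa [one_div, ← div_eq_inv_mul, le_div_iff₀ hN, mul_comm] at h1
    · right
      have h1 : 1 / (n : ℝ) * ∑ i, Z i ω ≤ m - a := by linarith
      rwa [one_div, ← div_eq_inv_mul, div_le_iff₀ hN, mul_comm] at h1
  calc _ ≤ _ := measureReal_mono hsub
    _ ≤ _ := measureReal_union_le _ _
    _ ≤ 2 * Real.exp (-τ) := by linarith

end Chernoff

/-! ### Spectral norm, trace and effective rank -/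

section SpectralNorm

variable {p : ℕ}

theorem norm_toLp_mulVec_le (A : Matrix (Fin p) (Fin p) ℝ) (x : EuclideanSpace ℝ (Fin p)) :
    ‖WithLp.toLp 2 (A *ᵥ x.ofLp)‖ ≤ specNorm A * ‖x‖ :=
  (Matrix.toEuclideanCLM (𝕜 := ℝ) A).le_opNorm x

theorem apply_self_le_specNorm (A : Matrix (Fin p) (Fin p) ℝ) (j : Fin p) :
    A j j ≤ specNorm A := by
  have h := norm_toLp_mulVec_le A (EuclideanSpace.single j 1)
  rw [PiLp.norm_single, norm_one, mul_one] at h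
  refine (le_abs_self _).trans (le_trans ?_ h)
  have h1 := PiLp.norm_apply_le (WithLp.toLp 2 (A *ᵥ (EuclideanSpace.single j (1 : ℝ)).ofLp)) j
  simpa using h1

theorem le_specNorm_of_mulVec_eq {A : Matrix (Fin p) (Fin p) ℝ} {x : EuclideanSpace ℝ (Fin p)}
    (hx : ‖x‖ = 1) {m : ℝ} (h : A *ᵥ x.ofLp = m • x.ofLp) : m ≤ specNorm A := by
  have h1 := norm_toLp_mulVec_le A x
  rw [h, WithLp.toLp_smul, WithLp.toLp_ofLp, norm_smul, hx, mul_one, mul_one] at h1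
  exact (le_abs_self m).trans h1

theorem dotProduct_mulVec_le_trace {A : Matrix (Fin p) (Fin p) ℝ} (hA : A.PosSemidef)
    (x : EuclideanSpace ℝ (Fin p)) : x.ofLp ⬝ᵥ A *ᵥ x.ofLp ≤ A.trace * ‖x‖ ^ 2 := by
  rw [dotProduct_mulVec_self_eq_sum hA.isHermitian, hA.isHermitian.trace_eq_sum_eigenvalues]
  simp only [RCLike.ofReal_real_eq_id, id_eq]
  rw [Finset.sum_mul]
  refine Finset.sum_le_sum fun i _ => mul_le_mul_of_nonneg_left ?_ (hA.eigenvalues_nonneg i)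
  rw [← hA.isHermitian.eigenvectorBasis.sum_sq_inner_right x]
  exact Finset.single_le_sum
    (f := fun i => inner ℝ (hA.isHermitian.eigenvectorBasis i) x ^ 2)
    (fun _ _ => sq_nonneg _) (Finset.mem_univ i)

/-- The Frobenius norm lies in between: `A ⪯ tr(A) I` gives `tr A² ≤ (tr A)²`. -/
theorem specNorm_le_trace {A : Matrix (Fin p) (Fin p) ℝ} (hA : A.PosSemidef) :
    specNorm A ≤ A.trace := by
  have htr : 0 ≤ A.trace := hA.trace_nonneg
  have hfro : frobSq A ≤ A.trace ^ 2 := by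
    rw [← trace_mul_self_eq_frobSq hA.isHermitian]
    refine (trace_mul_le_of_dotProduct_mulVec_le (B := A.trace • 1) hA fun x => ?_).trans
      (le_of_eq ?_)
    · refine (dotProduct_mulVec_le_trace hA (WithLp.toLp 2 x)).trans (le_of_eq ?_)
      rw [← real_inner_self_eq_norm_sq, inner_eq_dotProduct, smul_mulVec, one_mulVec,
        dotProduct_smul, smul_eq_mul]
    · rw [smul_mul_assoc, one_mul, trace_smul, smul_eq_mul, sq]
  refine ContinuousLinearMap.opNorm_le_bound _ htr fun x => ?_
  change ‖WithLp.toLp 2 (A *ᵥ x.ofLp)‖ ≤ _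
  refine (sq_le_sq₀ (norm_nonneg _) (by positivity)).1 ?_
  rw [mul_pow, EuclideanSpace.real_norm_sq_eq, EuclideanSpace.real_norm_sq_eq]
  refine le_trans ?_ (mul_le_mul_of_nonneg_right hfro (Finset.sum_nonneg fun _ _ => sq_nonneg _))
  rw [frobSq, Finset.sum_mul]
  exact Finset.sum_le_sum fun j _ =>
    Finset.sum_mul_sq_le_sq_mul_sq Finset.univ (fun k => A j k) x.ofLp

theorem one_le_effRank {A : Matrix (Fin p) (Fin p) ℝ} (hA : A.PosSemidef)
    (h : 0 < specNorm A) : 1 ≤ effRank A := by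
  rw [effRank, le_div_iff₀ h, one_mul]
  exact specNorm_le_trace hA

end SpectralNorm

/-! ### Exponential moments and the covariance matrix -/

section Moments

variable {Ω : Type*} [MeasurableSpace Ω] {P : Measure Ω}

/-- A bound on the `ψ₂` norm gives a square-exponential moment. -/
theorem integral_exp_sq_div_le_of_psi2Norm_lt [IsProbabilityMeasure P]
    {Z : Ω → ℝ} (hZ : AEMeasurable Z P) {K : ℝ}
    (hK : 0 < K) (h : psi2Norm Z P < ENNReal.ofReal (Real.sqrt K)) :
    Integrable (fun ω => Real.exp (Z ω ^ 2 / K)) P ∧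
      ∫ ω, Real.exp (Z ω ^ 2 / K) ∂P ≤ 2 := by
  -- The strict inequality provides an admissible `C < √K`, with no need for the infimum to be
  -- attained.
  obtain ⟨c, ⟨C, hC, rfl, hint⟩, hlt⟩ := sInf_lt_iff.1 h
  have hCK : C ^ 2 ≤ K := by
    have := (ENNReal.ofReal_lt_ofReal_iff (Real.sqrt_pos.2 hK)).1 hlt
    rw [← Real.sq_sqrt hK.le]
    gcongr
  have hm : AEMeasurable (fun ω => Real.exp (Z ω ^ 2 / K)) P :=
    ((hZ.pow_const 2).div_const K).exp
  have hle : ∫⁻ ω, ENNReal.ofReal (Real.exp (Z ω ^ 2 / K)) ∂P ≤ 2 := by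
    calc ∫⁻ ω, ENNReal.ofReal (Real.exp (Z ω ^ 2 / K)) ∂P
        ≤ ∫⁻ ω, (ENNReal.ofReal (Real.exp ((|Z ω| / C) ^ 2) - 1) + 1) ∂P := by
          refine lintegral_mono fun ω => ?_
          rw [← ENNReal.ofReal_one, ← ENNReal.ofReal_add
            (sub_nonneg.2 (Real.one_le_exp (sq_nonneg _))) zero_le_one, sub_add_cancel]
          refine ENNReal.ofReal_le_ofReal (Real.exp_le_exp.2 ?_)
          rw [div_pow, sq_abs]
          gcongr
      _ ≤ 1 + 1 := by
          rw [lintegral_add_right _ measurable_const]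
          simp only [lintegral_const, measure_univ, mul_one]
          gcongr
      _ = 2 := one_add_one_eq_two
  have hnn : 0 ≤ᵐ[P] fun ω => Real.exp (Z ω ^ 2 / K) :=
    ae_of_all _ fun ω => (Real.exp_pos _).le
  constructor
  · refine ⟨hm.aestronglyMeasurable, ?_⟩
    rw [hasFiniteIntegral_iff_ofReal hnn]
    exact hle.trans_lt (by simp)
  · rw [integral_eq_lintegral_of_nonneg_ae hnn hm.aestronglyMeasurable]
    exact ENNReal.toReal_le_of_le_ofReal (by norm_num) (by simpa using hle)

/-- A product of sub-Gaussian variables is sub-exponential: `|YZ| ≤ (Y² + Z²) / 2`, then the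
arithmetic–geometric mean inequality for the exponentials. -/
theorem integral_exp_abs_mul_div_le {Y Z : Ω → ℝ} (hY : AEMeasurable Y P)
    (hZ : AEMeasurable Z P) {K : ℝ} (hK : 0 < K)
    (hYi : Integrable (fun ω => Real.exp (Y ω ^ 2 / K)) P)
    (hYle : ∫ ω, Real.exp (Y ω ^ 2 / K) ∂P ≤ 2)
    (hZi : Integrable (fun ω => Real.exp (Z ω ^ 2 / K)) P)
    (hZle : ∫ ω, Real.exp (Z ω ^ 2 / K) ∂P ≤ 2) :
    Integrable (fun ω => Real.exp (|Y ω * Z ω| / K)) P ∧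
      ∫ ω, Real.exp (|Y ω * Z ω| / K) ∂P ≤ 2 := by
  have hpt : ∀ ω, Real.exp (|Y ω * Z ω| / K)
      ≤ (1 / 2) * (Real.exp (Y ω ^ 2 / K) + Real.exp (Z ω ^ 2 / K)) := by
    intro ω
    have h1 : |Y ω * Z ω| / K ≤ Y ω ^ 2 / K / 2 + Z ω ^ 2 / K / 2 := by
      rw [div_right_comm, div_right_comm (Z ω ^ 2), ← add_div, abs_mul]
      gcongr
      rw [← sq_abs (Y ω), ← sq_abs (Z ω)]
      linarith [two_mul_le_add_sq |Y ω| |Z ω|]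
    have h2 : ∀ x : ℝ, Real.exp x = Real.exp (x / 2) ^ 2 := fun x => by
      rw [sq, ← Real.exp_add, add_halves]
    calc _ ≤ _ := Real.exp_le_exp.2 h1
      _ ≤ _ := by
        rw [Real.exp_add, h2 (Y ω ^ 2 / K), h2 (Z ω ^ 2 / K)]
        linarith [two_mul_le_add_sq (Real.exp (Y ω ^ 2 / K / 2)) (Real.exp (Z ω ^ 2 / K / 2))]
  have hm : AEMeasurable (fun ω => Real.exp (|Y ω * Z ω| / K)) P :=
    (((hY.mul hZ).abs).div_const K).exp
  have hbi := (hYi.add hZi).const_mul (1 / 2)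
  have hi : Integrable (fun ω => Real.exp (|Y ω * Z ω| / K)) P := by
    refine Integrable.mono' hbi hm.aestronglyMeasurable (ae_of_all _ fun ω => ?_)
    rw [Real.norm_eq_abs, Real.abs_exp]
    exact hpt ω
  refine ⟨hi, (integral_mono hi hbi hpt).trans ?_⟩
  rw [integral_const_mul]
  simp only [Pi.add_apply]
  rw [integral_add hYi hZi]
  linarith

variable {p : ℕ} {Xt : Ω → Fin p → ℝ}

theorem dotProduct_single_one (x : Fin p → ℝ) (j : Fin p) : x ⬝ᵥ Pi.single j 1 = x j := by
  simp

theorem IsSubGaussian.integrable_mul [IsProbabilityMeasure P]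
    (hXt : AEMeasurable Xt P) (h : IsSubGaussian Xt P)
    (j k : Fin p) : Integrable (fun ω => Xt ω j * Xt ω k) P := by
  have hm : ∀ j, AEMeasurable (fun ω => Xt ω j) P := fun j =>
    (measurable_pi_apply j).comp_aemeasurable hXt
  have hsq : ∀ j, MemLp (fun ω => Xt ω j) 2 P := by
    intro j
    have hj := h (Pi.single j 1)
    simp only [dotProduct_single_one] at hj
    set K : ℝ := ((psi2Norm (fun ω => Xt ω j) P).toReal + 1) ^ 2 with hK
    have hpos : 0 < (psi2Norm (fun ω => Xt ω j) P).toReal + 1 := by positivity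
    have hK0 : 0 < K := by positivity
    have hlt : psi2Norm (fun ω => Xt ω j) P < ENNReal.ofReal (Real.sqrt K) := by
      rw [hK, Real.sqrt_sq hpos.le, ENNReal.lt_ofReal_iff_toReal_lt hj.ne]
      linarith
    have hi := (integral_exp_sq_div_le_of_psi2Norm_lt (hm j) hK0 hlt).1
    rw [memLp_two_iff_integrable_sq (hm j).aestronglyMeasurable]
    refine integrable_of_integrable_exp_abs_div ((hm j).pow_const 2) hK0 ?_
    simpa only [abs_sq] using hi
  exact (hsq j).integrable_mul (hsq k)

theorem dotProduct_covMatrix_mulVec (hint : ∀ j k, Integrable (fun ω => Xt ω j * Xt ω k) P)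
    (x : Fin p → ℝ) : x ⬝ᵥ covMatrix Xt P *ᵥ x = ∫ ω, (Xt ω ⬝ᵥ x) ^ 2 ∂P := by
  have h1 : ∀ ω, (Xt ω ⬝ᵥ x) ^ 2 = ∑ j, ∑ k, x j * x k * (Xt ω j * Xt ω k) := by
    intro ω
    rw [sq, dotProduct, Finset.sum_mul_sum]
    exact Finset.sum_congr rfl fun j _ => Finset.sum_congr rfl fun k _ => by ring
  simp_rw [h1]
  rw [integral_finsetSum _ fun j _ => integrable_finsetSum _ fun k _ => (hint j k).const_mul _]
  refine Finset.sum_congr rfl fun j _ => ?_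
  rw [integral_finsetSum _ fun k _ => (hint j k).const_mul _]
  simp only [mulVec, dotProduct, Finset.mul_sum, covMatrix, of_apply]
  refine Finset.sum_congr rfl fun k _ => ?_
  rw [integral_const_mul]
  ring

theorem covMatrix_posSemidef (hint : ∀ j k, Integrable (fun ω => Xt ω j * Xt ω k) P) :
    (covMatrix Xt P).PosSemidef := by
  refine PosSemidef.of_dotProduct_mulVec_nonneg (covMatrix_isHermitian Xt P) fun x => ?_
  rw [star_trivial, dotProduct_covMatrix_mulVec hint]
  exact integral_nonneg fun ω => sq_nonneg _

end Moments

/-! ### Bernoulli masks and inverse-probability weighting -/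

section Mask

variable {Ω : Type*} [MeasurableSpace Ω] {P : Measure Ω}

theorem ae_eq_zero_or_one_of_bernoulli {B : Ω → ℝ} {δ : unitInterval}
    (h : HasLaw B (bernoulliMeasure (1 : ℝ) 0 δ) P) : ∀ᵐ ω ∂P, B ω = 0 ∨ B ω = 1 := by
  have hset : MeasurableSet {x : ℝ | x = 0 ∨ x = 1} :=
    (measurableSet_singleton 0).union (measurableSet_singleton 1)
  rw [h.ae_iff (p := fun x : ℝ => x = 0 ∨ x = 1) (measurableSet_setOfPred.1 hset), ae_iff]
  change bernoulliMeasure (1 : ℝ) 0 δ {x : ℝ | x = 0 ∨ x = 1}ᶜ = 0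
  rw [bernoulliMeasure_apply_of_notMem_of_notMem δ hset.compl (by simp) (by simp)]

theorem integral_of_bernoulli {B : Ω → ℝ} {δ : unitInterval}
    (h : HasLaw B (bernoulliMeasure (1 : ℝ) 0 δ) P) : ∫ ω, B ω ∂P = δ := by
  rw [h.integral_eq, integral_bernoulliMeasure]
  simp

variable {n p : ℕ} {D : Fin n → Fin p → Ω → ℝ}

/-- Off the diagonal, columns `j` and `k` are disjoint blocks of the family, hence independent of
each other, and can be paired row by row. -/
theorem iIndepFun_mul_mask [IsProbabilityMeasure P] (hDm : ∀ i j, AEMeasurable (D i j) P)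
    (hD : iIndepFun (fun (ij : Fin n × Fin p) ω => D ij.1 ij.2 ω) P) (j k : Fin p) :
    iIndepFun (fun i ω => D i j ω * D i k ω) P := by
  have hcol : ∀ j, iIndepFun (fun i => D i j) P := fun j =>
    hD.precomp (g := fun i : Fin n => (i, j)) fun a b hab => (Prod.ext_iff.1 hab).1
  by_cases hjk : j = k
  · subst hjk
    exact (hcol j).comp (fun _ x => x * x) fun _ => measurable_id.mul measurable_id
  · have hdisj : Disjoint ((Finset.univ : Finset (Fin n)) ×ˢ {j})
        ((Finset.univ : Finset (Fin n)) ×ˢ {k}) := by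
      rw [Finset.disjoint_left]
      rintro ⟨a, b⟩ h1 h2
      simp only [Finset.mem_product, Finset.mem_univ, Finset.mem_singleton, true_and] at h1 h2
      exact hjk (h1.symm.trans h2)
    have hind := hD.indepFun_finset₀ _ _ hdisj fun ij => hDm ij.1 ij.2
    have hpair : IndepFun (fun ω i => D i j ω) (fun ω i => D i k ω) P :=
      hind.comp
        (φ := fun f (i : Fin n) => f ⟨(i, j), by simp⟩)
        (ψ := fun f (i : Fin n) => f ⟨(i, k), by simp⟩)
        (measurable_pi_lambda _ fun i => measurable_pi_apply _)
        (measurable_pi_lambda _ fun i => measurable_pi_apply _)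
    exact (iIndepFun_prodMk_of_indepFun (fun i => hDm i j) (fun i => hDm i k) (hcol j)
      (hcol k) hpair).comp (fun _ x => x.1 * x.2) fun _ => measurable_fst.mul measurable_snd

/-- The probability that both entries `j` and `k` of a row are observed. -/
def pairProb (δ : ℝ) (j k : Fin p) : ℝ := if j = k then δ else δ ^ 2

theorem integral_mul_mask {δ : unitInterval}
    (hlaw : ∀ i j, HasLaw (D i j) (bernoulliMeasure (1 : ℝ) 0 δ) P)
    (hD : iIndepFun (fun (ij : Fin n × Fin p) ω => D ij.1 ij.2 ω) P) (i : Fin n)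
    (j k : Fin p) : ∫ ω, D i j ω * D i k ω ∂P = pairProb δ j k := by
  by_cases hjk : j = k
  · subst hjk
    rw [pairProb, if_pos rfl, ← integral_of_bernoulli (hlaw i j)]
    refine integral_congr_ae ?_
    filter_upwards [ae_eq_zero_or_one_of_bernoulli (hlaw i j)] with ω h
    rcases h with h | h <;> simp [h]
  · have hind : IndepFun (D i j) (D i k) P :=
      hD.indepFun (i := (i, j)) (j := (i, k)) fun h => hjk (Prod.ext_iff.1 h).2
    rw [hind.integral_fun_mul_eq_mul_integral (hlaw i j).aemeasurable.aestronglyMeasurable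
      (hlaw i k).aemeasurable.aestronglyMeasurable, integral_of_bernoulli (hlaw i j),
      integral_of_bernoulli (hlaw i k), pairProb, if_neg hjk, sq]

/-- On the diagonal `1/δ² - (1-δ)/δ² = 1/δ`, so the correction weights each product by the inverse
of its observation probability. -/
theorem biasCorrected_maskedData_apply {δ : ℝ} (hδ : δ ≠ 0) (X D : Fin n → Fin p → ℝ)
    (j k : Fin p) :
    biasCorrected δ (maskedData X D) j k
      = 1 / (n : ℝ) * ∑ i, D i j * D i k * (X i j * X i k) / pairProb δ j k := by
  have h1 : ((1 / (n : ℝ)) • ((maskedData X D).transpose * maskedData X D)) j k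
      = 1 / (n : ℝ) * ∑ i, D i j * D i k * (X i j * X i k) := by
    simp only [Matrix.smul_apply, Matrix.mul_apply, transpose_apply, maskedData, of_apply,
      smul_eq_mul]
    congr 1
    exact Finset.sum_congr rfl fun i _ => by ring
  set S : Matrix (Fin p) (Fin p) ℝ :=
    (1 / (n : ℝ)) • ((maskedData X D).transpose * maskedData X D) with hS
  change ((1 / δ ^ 2) • S - ((1 - δ) / δ ^ 2) • diagonal S.diag) j k = _
  rw [Matrix.sub_apply, Matrix.smul_apply, Matrix.smul_apply, ← Finset.sum_div]
  by_cases hjk : j = k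
  · subst hjk
    rw [diagonal_apply_eq, diag_apply, h1, pairProb, if_pos rfl]
    simp only [smul_eq_mul]
    field_simp
    ring
  · rw [diagonal_apply_ne _ hjk, h1, pairProb, if_neg hjk]
    simp only [smul_eq_mul]
    field_simp
    ring

end Mask

/-! ### Entrywise deviation against the noise level -/

section Deviation

variable {Ω : Type*} [MeasurableSpace Ω] {P : Measure Ω} [IsProbabilityMeasure P]

/-- Deviation of one entry of the bias-corrected covariance estimator. -/
theorem measureReal_le_abs_biasCorrected_sub_le {n p : ℕ} (hn : 1 ≤ n)
    {Xt : Ω → Fin p → ℝ} {X : Fin n → Ω → Fin p → ℝ} {D : Fin n → Fin p → Ω → ℝ}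
    {δ : unitInterval} (hδ : 0 < (δ : ℝ)) {K : ℝ} (hK : 0 < K)
    (hmom : ∀ j, Integrable (fun ω => Real.exp (Xt ω j ^ 2 / K)) P ∧
      ∫ ω, Real.exp (Xt ω j ^ 2 / K) ∂P ≤ 2)
    (hXid : ∀ i, IdentDistrib (X i) Xt P P) (hX : iIndepFun X P)
    (hlaw : ∀ i j, HasLaw (D i j) (bernoulliMeasure (1 : ℝ) 0 δ) P)
    (hD : iIndepFun (fun (ij : Fin n × Fin p) ω => D ij.1 ij.2 ω) P)
    (hXD : IndepFun (fun ω i => X i ω) (fun ω i j => D i j ω) P) (j k : Fin p)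
    {τ a : ℝ} (hτ : 0 < τ)
    (ha₁ : 34 * (K * Real.sqrt (τ / ((δ : ℝ) ^ 2 * n))) ≤ a)
    (ha₂ : 34 * (K * (τ / ((δ : ℝ) ^ 2 * n))) ≤ a) :
    P.real {ω | a ≤ |(biasCorrected (δ : ℝ) (maskedData (fun i => X i ω) (fun i j => D i j ω))
      - covMatrix Xt P) j k|} ≤ 2 * Real.exp (-τ) := by
  have hN : (0 : ℝ) < n := by exact_mod_cast hn
  have hXt : AEMeasurable Xt P := (hXid ⟨0, hn⟩).aemeasurable_snd
  have hXtm : ∀ j, AEMeasurable (fun ω => Xt ω j) P := fun j =>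
    (measurable_pi_apply j).comp_aemeasurable hXt
  have hXm : ∀ i, AEMeasurable (X i) P := fun i => (hXid i).aemeasurable_fst
  have hDm : ∀ i j, AEMeasurable (D i j) P := fun i j => (hlaw i j).aemeasurable
  set w := pairProb (δ : ℝ) j k with hw
  have hwδ : (δ : ℝ) ^ 2 ≤ w := by
    rw [hw, pairProb]
    split_ifs
    · have := δ.2.2
      nlinarith
    · exact le_rfl
  have hδ2 : 0 < (δ : ℝ) ^ 2 := by positivity
  have hw0 : 0 < w := hδ2.trans_le hwδ
  set q : (Fin p → ℝ) → ℝ := fun x => x j * x k with hq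
  have hqm : Measurable q := (measurable_pi_apply j).mul (measurable_pi_apply k)
  have hBm : ∀ i, AEMeasurable (fun ω => D i j ω * D i k ω) P := fun i =>
    (hDm i j).mul (hDm i k)
  have hQm : ∀ i, AEMeasurable (fun ω => q (X i ω)) P := fun i =>
    hqm.comp_aemeasurable (hXm i)
  have hjoint : IndepFun (fun ω i => D i j ω * D i k ω) (fun ω i => q (X i ω)) P :=
    hXD.symm.comp (φ := fun d (i : Fin n) => d i j * d i k)
      (ψ := fun x (i : Fin n) => q (x i))
      (measurable_pi_lambda _ fun i => by fun_prop)
      (measurable_pi_lambda _ fun i => hqm.comp (measurable_pi_apply i))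
  have hZ : iIndepFun (fun i ω => D i j ω * D i k ω * q (X i ω) / w) P :=
    (iIndepFun_prodMk_of_indepFun hBm hQm (iIndepFun_mul_mask hDm hD j k)
      (hX.comp (fun _ => q) fun _ => hqm) hjoint).comp (fun _ x => x.1 * x.2 / w)
      fun _ => by fun_prop
  have hexp := integral_exp_abs_mul_div_le (hXtm j) (hXtm k) hK (hmom j).1 (hmom j).2
    (hmom k).1 (hmom k).2
  have hmgf : ∀ i, ∀ l : ℝ, |l| * (K / w) ≤ 1 / 2 →
      Integrable (fun ω => Real.exp (l * (D i j ω * D i k ω * q (X i ω) / w))) P ∧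
      mgf (fun ω => D i j ω * D i k ω * q (X i ω) / w) P l
        ≤ Real.exp (l * covMatrix Xt P j k + 16 * l ^ 2 * (K ^ 2 / w)) := by
    intro i l hl
    have hB01 : ∀ᵐ ω ∂P, D i j ω * D i k ω = 0 ∨ D i j ω * D i k ω = 1 := by
      filter_upwards [ae_eq_zero_or_one_of_bernoulli (hlaw i j),
        ae_eq_zero_or_one_of_bernoulli (hlaw i k)] with ω h1 h2
      rcases h1 with h1 | h1 <;> rcases h2 with h2 | h2 <;> simp [h1, h2]
    have hid := (hXid i).comp (u := fun x => Real.exp (|q x| / K)) (by fun_prop)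
    have hidq := (hXid i).comp (u := q) hqm
    have hmean : ∫ ω, q (X i ω) ∂P = covMatrix Xt P j k := hidq.integral_eq
    rw [← hmean]
    exact mgf_masked_le (hBm i) (hQm i)
      (hjoint.comp (measurable_pi_apply i) (measurable_pi_apply i)) hK hw0 hB01
      (integral_mul_mask hlaw hD i j k) (hid.integrable_iff.2 hexp.1)
      (hid.integral_eq.trans_le hexp.2) hl
  -- Since `δ² ≤ w`, diagonal and off-diagonal entries share one bound.
  have hden : τ / (w * n) ≤ τ / ((δ : ℝ) ^ 2 * n) := by gcongr
  have key := measureReal_le_abs_sum_sub_le hn (fun i => ((hBm i).mul (hQm i)).div_const w)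
    hZ (v := K ^ 2 / w) (b := K / w) (by positivity) (by positivity) hτ hmgf
    (a := a) (by
      refine le_trans ?_ ha₁
      rw [show K ^ 2 / w * τ / n = K ^ 2 * (τ / (w * n)) by field_simp,
        Real.sqrt_mul (sq_nonneg _), Real.sqrt_sq hK.le]
      gcongr) (by
      refine le_trans ?_ ha₂
      rw [show K / w * τ / n = K * (τ / (w * n)) by field_simp]
      gcongr)
  refine le_trans (le_of_eq ?_) key
  congr 1
  ext ω
  rw [Set.mem_ofPred_eq, Set.mem_ofPred_eq, Matrix.sub_apply,
    biasCorrected_maskedData_apply hδ.ne']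
  rfl

/-- The noise level dominates the deviations of the entries at confidence `3 log (2 p)`. -/
theorem deviation_le_noiseLevel {n p : ℕ} (hn : 1 ≤ n) (hp : 2 ≤ p) {c₁ δ : ℝ} (hc : 0 < c₁)
    (hδ : 0 < δ) {A : Matrix (Fin p) (Fin p) ℝ} (hA : 0 < specNorm A) (hr : 1 ≤ effRank A) :
    34 * (4 * (specNorm A / c₁) * Real.sqrt (3 * Real.log (2 * p) / (δ ^ 2 * n)))
        ≤ noiseLevel 1000 c₁ δ n A (Real.log (2 * p)) / 2 ∧
      34 * (4 * (specNorm A / c₁) * (3 * Real.log (2 * p) / (δ ^ 2 * n)))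
        ≤ noiseLevel 1000 c₁ δ n A (Real.log (2 * p)) / 2 := by
  have hN : (1 : ℝ) ≤ n := by exact_mod_cast hn
  have hp' : (2 : ℝ) ≤ p := by exact_mod_cast hp
  set L := Real.log (2 * p) with hL
  -- `2p ≥ 4 > e`. This makes the factor `c₁ δ + L + log n` at least `1`.
  have hL1 : 1 ≤ L := by
    rw [hL, Real.le_log_iff_exp_le (by positivity)]
    linarith [Real.exp_one_lt_d9]
  have hlogn : 0 ≤ Real.log n := Real.log_nonneg hN
  set y := L / (δ ^ 2 * n) with hy
  have hy0 : 0 ≤ y := by positivity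
  set κ := specNorm A / c₁ with hκ
  have hκ0 : 0 < κ := by positivity
  have harg : 2 * y ≤ effRank A * (L + L) / (δ ^ 2 * n) := by
    rw [show effRank A * (L + L) / (δ ^ 2 * n) = effRank A * (2 * y) by rw [hy]; ring]
    nlinarith
  rw [show 3 * L / (δ ^ 2 * n) = 3 * y by rw [hy]; ring]
  constructor
  · have h1 : Real.sqrt (3 * y) ≤ 2 * Real.sqrt (effRank A * (L + L) / (δ ^ 2 * n)) := by
      refine Real.sqrt_le_iff.2 ⟨by positivity, ?_⟩
      rw [mul_pow, Real.sq_sqrt (by linarith)]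
      linarith
    -- The constant `1000` leaves room: `34 * 4 * 2 = 272 ≤ 500` here, and `34 * 4 * 3 = 408 ≤ 1000`
    -- in the linear regime.
    calc 34 * (4 * κ * Real.sqrt (3 * y))
        ≤ 34 * (4 * κ * (2 * Real.sqrt (effRank A * (L + L) / (δ ^ 2 * n)))) := by gcongr
      _ ≤ 1000 * κ * Real.sqrt (effRank A * (L + L) / (δ ^ 2 * n)) / 2 := by
          have : 0 ≤ κ * Real.sqrt (effRank A * (L + L) / (δ ^ 2 * n)) := by positivity
          linarith
      _ ≤ _ := by
          rw [noiseLevel]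
          gcongr
          exact le_max_left _ _
  · have h2 : 2 * y ≤ effRank A * (L + L) / (δ ^ 2 * n) * (c₁ * δ + L + Real.log n) := by
      have : 0 < c₁ * δ := by positivity
      refine harg.trans (le_mul_of_one_le_right (by linarith) (by linarith))
    calc 34 * (4 * κ * (3 * y)) ≤ 1000 * κ * (2 * y) / 2 := by
          have : 0 ≤ κ * y := by positivity
          linarith
      _ ≤ _ := by
          rw [noiseLevel]
          gcongr
          exact h2.trans (le_max_right _ _)

end Deviation

/-! ### The high-probability event -/

section GoodEvent

variable {Ω : Type*} [MeasurableSpace Ω] {P : Measure Ω} [IsProbabilityMeasure P]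

/-- A union bound over the entries of a random matrix. -/
theorem exists_measurableSet_forall_lt {p : ℕ} {Z : Fin p → Fin p → Ω → ℝ} {a η : ℝ}
    (h : ∀ j k, P.real {ω | a ≤ Z j k ω} ≤ η) :
    ∃ E : Set Ω, MeasurableSet E ∧ 1 - (p : ℝ) ^ 2 * η ≤ P.real E ∧
      ∀ ω ∈ E, ∀ j k, Z j k ω < a := by
  -- No measurability of `Z` is assumed, so each bad set is replaced by a measurable superset of
  -- equal measure.
  set N : Set Ω := ⋃ q : Fin p × Fin p, toMeasurable P {ω | a ≤ Z q.1 q.2 ω} with hN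
  have hNm : MeasurableSet N := MeasurableSet.iUnion fun q => measurableSet_toMeasurable _ _
  have hNle : P.real N ≤ (p : ℝ) ^ 2 * η := by
    refine (measureReal_iUnion_fintype_le _).trans ?_
    refine (Finset.sum_le_card_nsmul _ _ η fun q _ => ?_).trans (le_of_eq ?_)
    · rw [measureReal_def, measure_toMeasurable]
      exact h q.1 q.2
    · simp [sq]
  refine ⟨Nᶜ, hNm.compl, ?_, fun ω hω j k => ?_⟩
  · rw [probReal_compl_eq_one_sub hNm]
    linarith
  · by_contra hle
    exact hω (Set.mem_iUnion.2 ⟨(j, k), subset_toMeasurable _ _ (not_lt.1 hle)⟩)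

theorem sq_mul_exp_neg_three_mul_log_le {p : ℕ} (hp : 2 ≤ p) :
    (p : ℝ) ^ 2 * (2 * Real.exp (-(3 * Real.log (2 * p)))) ≤ Real.exp (-Real.log (2 * p)) := by
  have hp' : (2 : ℝ) ≤ p := by exact_mod_cast hp
  have h2p : (0 : ℝ) < 2 * p := by positivity
  rw [show -(3 * Real.log (2 * (p : ℝ))) = -Real.log (2 * p) + -Real.log (2 * p)
    + -Real.log (2 * p) by ring, Real.exp_add, Real.exp_add, Real.exp_neg, Real.exp_log h2p,
    show (p : ℝ) ^ 2 * (2 * ((2 * (p : ℝ))⁻¹ * (2 * (p : ℝ))⁻¹ * (2 * (p : ℝ))⁻¹))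
      = (2 * (p : ℝ))⁻¹ * (1 / 2) by field_simp]
  exact mul_le_of_le_one_right (by positivity) (by norm_num)

/-- At a basis vector, `c₁ ‖X_j‖²_{ψ₂} ≤ E X_j² = Σ_jj ≤ ‖Σ‖`. The factor `4` makes the comparison
strict. -/
theorem exp_moment_of_psi2Norm_le {p : ℕ} {Xt : Ω → Fin p → ℝ} (hXt : AEMeasurable Xt P)
    (hsub : IsSubGaussian Xt P) {c₁ : ℝ} (hc : 0 < c₁)
    (hpsi : ∀ u : Fin p → ℝ,
      c₁ * (psi2Norm (fun ω => Xt ω ⬝ᵥ u) P).toReal ^ 2 ≤ ∫ ω, (Xt ω ⬝ᵥ u) ^ 2 ∂P)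
    (hpos : 0 < specNorm (covMatrix Xt P)) (j : Fin p) :
    Integrable (fun ω => Real.exp (Xt ω j ^ 2 / (4 * (specNorm (covMatrix Xt P) / c₁)))) P ∧
      ∫ ω, Real.exp (Xt ω j ^ 2 / (4 * (specNorm (covMatrix Xt P) / c₁))) ∂P ≤ 2 := by
  have hj := hsub (Pi.single j 1)
  have hp1 := hpsi (Pi.single j 1)
  simp only [dotProduct_single_one] at hj hp1
  have hm : AEMeasurable (fun ω => Xt ω j) P := (measurable_pi_apply j).comp_aemeasurable hXt
  refine integral_exp_sq_div_le_of_psi2Norm_lt hm (by positivity) ?_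
  rw [ENNReal.lt_ofReal_iff_toReal_lt hj.ne]
  refine Real.lt_sqrt_of_sq_lt ?_
  have h1 : ∫ ω, Xt ω j ^ 2 ∂P ≤ specNorm (covMatrix Xt P) := by
    have := apply_self_le_specNorm (covMatrix Xt P) j
    simpa only [covMatrix, of_apply, ← sq] using this
  rw [← mul_div_assoc, lt_div_iff₀ hc]
  linarith

end GoodEvent

end SparsePCA

end

/-! ### The main theorem -/

theorem mainTheorem5 :
    -- two absolute constants: `C` in `ε`, `C'` in the noise level
    ∃ C C' : ℝ, 0 < C ∧ 0 < C' ∧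
      ∀ (n p : ℕ) (_hn : 1 ≤ n) (hp : 2 ≤ p)
        (Ω : Type*) [MeasurableSpace Ω] (P : Measure Ω) [IsProbabilityMeasure P]
        -- `Xt` is the generic random vector, `X i` its copies, `D i j` the observation indicators
        (Xt : Ω → Fin p → ℝ) (X : Fin n → Ω → Fin p → ℝ) (D : Fin n → Fin p → Ω → ℝ)
        (δ : unitInterval) (c₁ : ℝ),
        0 < (δ : ℝ) → 0 < c₁ →
        SparsePCA.IsSubGaussian Xt P →
        (∀ u : Fin p → ℝ,
          c₁ * (SparsePCA.psi2Norm (fun ω => Xt ω ⬝ᵥ u) P).toReal ^ 2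
            ≤ ∫ ω, (Xt ω ⬝ᵥ u) ^ 2 ∂P) →
        (∀ i, IdentDistrib (X i) Xt P P) →
        iIndepFun X P →
        (∀ i j, HasLaw (D i j) (bernoulliMeasure (1 : ℝ) 0 δ) P) →
        iIndepFun (fun (ij : Fin n × Fin p) ω => D ij.1 ij.2 ω) P →
        IndepFun (fun ω i => X i ω) (fun ω i j => D i j ω) P →
        -- the population quantities: `Λ₁ > Λ₂`, leading eigenvector `u₁`, `β⁰ = Λ₁^{1/2} u₁`
        ∀ (Λ₁ Λ₂ : ℝ),
        Λ₁ = SparsePCA.eigval (SparsePCA.covMatrix_isHermitian Xt P) 0 (by omega) →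
        Λ₂ = SparsePCA.eigval (SparsePCA.covMatrix_isHermitian Xt P) 1 (by omega) →
        Λ₂ < Λ₁ →
        ∀ (u₁ β₀ : EuclideanSpace ℝ (Fin p)),
        SparsePCA.IsLeadingEigenvector (SparsePCA.covMatrix Xt P) u₁ →
        β₀ = Real.sqrt Λ₁ • u₁ →
        ∀ (s : ℕ), (Finset.univ.filter (fun j => β₀ j ≠ 0)).card ≤ s →
        -- the tuning parameter
        ∀ (μ : ℝ),
        SparsePCA.noiseLevel C' c₁ δ n (SparsePCA.covMatrix Xt P) (Real.log (2 * p)) ≤ μ →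
        ∀ (ε α : ℝ),
        ε = SparsePCA.epsilon C s μ Λ₁ Λ₂ →
        α = SparsePCA.alpha s μ ε ‖β₀‖ →
        α < Λ₁ →
        ∃ E : Set Ω, MeasurableSet E ∧ 1 - Real.exp (-Real.log (2 * p)) ≤ P.real E ∧
          ∀ ω ∈ E, ∀ (S F : Matrix (Fin p) (Fin p) ℝ) (uhat : EuclideanSpace ℝ (Fin p)),
            S = SparsePCA.biasCorrected (δ : ℝ)
              (SparsePCA.maskedData (fun i => X i ω) (fun i j => D i j ω)) →
            SparsePCA.IsSDPSolution S μ F →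
            SparsePCA.IsLeadingEigenvector F uhat →
            0 ≤ inner ℝ uhat u₁ →
            ‖SparsePCA.betaInit S F uhat - β₀‖
              ≤ 1 / (2 * Real.sqrt (Λ₁ - α)) * α + 2 * Real.sqrt ε * Real.sqrt Λ₁ := by
  -- With `C = 4`, `ε = 4 s μ / (Λ₁ - Λ₂)` dominates the Frobenius error `3 s μ / (Λ₁ - Λ₂)`.
  refine ⟨4, 1000, by norm_num, by norm_num, ?_⟩
  intro n p hn hp Ω _ P _ Xt X D δ c₁ hδ hc hsub hpsi hXid hX hlaw hD hXD Λ₁ Λ₂ hΛ₁ hΛ₂ hgap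
    u₁ β₀ hu hβ s hs μ hμ ε α hε hα hαΛ
  have hXt : AEMeasurable Xt P := (hXid ⟨0, hn⟩).aemeasurable_snd
  have hpsd : (SparsePCA.covMatrix Xt P).PosSemidef :=
    SparsePCA.covMatrix_posSemidef (hsub.integrable_mul hXt)
  have hΛ₂0 : 0 ≤ Λ₂ := by
    have h := hpsd.eigenvalues_nonneg
      (Fintype.equivOfCardEq (Fintype.card_fin _) (⟨1, by simpa using by omega⟩ :
        Fin (Fintype.card (Fin p))))
    simp only [Matrix.IsHermitian.eigenvalues, Equiv.symm_apply_apply] at h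
    rw [hΛ₂]
    exact h
  have hΛ₁0 : 0 < Λ₁ := hΛ₂0.trans_lt hgap
  have hspec : 0 < SparsePCA.specNorm (SparsePCA.covMatrix Xt P) :=
    hΛ₁0.trans_le (SparsePCA.le_specNorm_of_mulVec_eq hu.1 (hΛ₁ ▸
      (hu.spectral_gap (SparsePCA.covMatrix_isHermitian Xt P) hp (hΛ₁ ▸ hΛ₂ ▸ hgap)).1))
  have hmom := SparsePCA.exp_moment_of_psi2Norm_le hXt hsub hc hpsi hspec
  have hlog : 0 < Real.log (2 * p) := by
    refine Real.log_pos ?_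
    have : (2 : ℝ) ≤ p := by exact_mod_cast hp
    linarith
  obtain ⟨hdev₁, hdev₂⟩ := SparsePCA.deviation_le_noiseLevel hn hp hc hδ hspec
    (SparsePCA.one_le_effRank hpsd hspec)
  have hμ2 := div_le_div_of_nonneg_right hμ (zero_le_two (α := ℝ))
  have hμ0 : 0 ≤ μ := by
    have h0 : 0 ≤ μ / 2 := le_trans (by positivity) (hdev₁.trans hμ2)
    linarith
  obtain ⟨E, hEm, hEP, hE⟩ := SparsePCA.exists_measurableSet_forall_lt fun j k =>
    SparsePCA.measureReal_le_abs_biasCorrected_sub_le hn hδ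
      (by positivity) hmom hXid hX hlaw hD hXD j k
      (mul_pos three_pos hlog) (hdev₁.trans hμ2) (hdev₂.trans hμ2)
  refine ⟨E, hEm, ?_, ?_⟩
  -- Union bound: `p² * 2 * (2p)⁻³ = 1 / (4p) ≤ 1 / (2p)`.
  · have := SparsePCA.sq_mul_exp_neg_three_mul_log_le hp
    linarith
  · intro ω hω S F uhat hS hF hv hvu
    refine SparsePCA.norm_betaInit_sub_le (SparsePCA.covMatrix_isHermitian Xt P) hp hΛ₁ hΛ₂ hgap
      hΛ₁0 hu hβ hs hμ0 hε hα hαΛ (fun j k => ?_) hF hv hvu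
    rw [hS]
    exact (hE ω hω j k).le
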